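/- **Model.** Bits are elements of $\mathbb{F}_2$. Let $\sigma_{00}=I$, $\sigma_{01}=X$, $\sigma_{10}=Z$, $\sigma_{11}=ZX$ be the $2\times 2$ Pauli matrices ($Y=-i\sigma_{11}$), and let $|\sigma_{ab}\rangle=\frac1{\sqrt2}\sum_{x,y}(\sigma_{ab})_{xy}|x\rangle|y\rangle$ be the Bell basis of two qubits. A signed $n$-qubit Pauli operator is $\pm P_1\otimes\dots\otimes P_n$ with $P_k\in\{I,X,Y,Z\}$. A unit vector $|\psi\rangle\in(\mathbb{C}^2)^{\otimes n}$ is a stabilizer state if exactly $2^n$ signed Pauli operators $M$ satisfy $M|\psi\rangle=|\psi\rangle$. A list $M_1,\dots,M_n$ of signed Pauli operators identifies $|\psi\rangle$ if $M_j|\psi\rangle=|\psi\rangle$ for all $j$, and every vector fixed by all $M_j$ is a scalar multiple of $|\psi\rangle$. A quantum algorithm is a finite program, the same for all $n$, for a random access machine with index registers (cleared, copied, incremented, compared, used as loop counters), bit arrays with two indices, and two $n$-qubit quantum registers. Classical operations on single bits and on index registers, tests, and loop iterations take one step each. The quantum operations are: (i) discard the contents of both quantum registers and load either one fresh copy of the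 unknown state $|\psi\rangle$ into the first register (and $|0^n\rangle$ into the second) or two fresh copies, one into each ($2n+1$ steps); (ii) measure the $i$-th qubit of the first register together with the $i$-th qubit of the second in the Bell basis (one step; doing so for all $i$ after loading two copies is Bell sampling); (iii) measure the $i$-th qubit of the first register in the eigenbasis of a one-qubit Pauli matrix (one step). The index registers initially hold $n$ and zeros, and the output is read from the bit arrays as a list of $n$ signed Pauli operators. **Theorem.** There are a program of this kind and a constant $C$ such that, for every $n\ge 0$ and every $n$-qubit stabilizer state $|\psi\rangle$, run with access to copies of $|\psi\rangle$: 1. in every run of positive probability, the program uses at most $5n+2$ copies of $|\psi\rangle$ and makes at most $C(n^3+1)$ steps; 2. the probability that its output does not identify $|\psi\rangle$ is at most $2^{-n}$. In particular, the only joint measurements on different copies are Bell-basis measurements on pairs of corresponding qubits of two copies, and at most two copies are ever acted on together. -/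

import Mathlib

namespace BellLearning

/-! ### States, Pauli operators, stabilizer states -/

/-- Labels of the computational basis of `n` qubits. -/
abbrev Bits (n : ℕ) : Type := Fin n → ZMod 2

/-- The matrix `σ_{ab}`: `σ_{00} = I`, `σ_{01} = X`, `σ_{10} = Z`,
`σ_{11} = Z X = [[0, 1], [-1, 0]]`. -/
noncomputable def sigma (a b : ZMod 2) : Matrix (ZMod 2) (ZMod 2) ℂ :=
  Matrix.of fun x y => if x + y = b then (-1) ^ (a * x).val else 0

/-- The Hermitian Pauli matrix proportional to `σ_{ab}`: `I`, `X`, `Z`, and `Y = -i σ_{11}`. -/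
noncomputable def pauli (a b : ZMod 2) : Matrix (ZMod 2) (ZMod 2) ℂ :=
  (if a = 1 ∧ b = 1 then -Complex.I else 1) • sigma a b

/-- A signed `n`-qubit Pauli operator in classical form: a sign bit, and two bits per qubit. -/
abbrev SignedPauli (n : ℕ) : Type := ZMod 2 × (Fin n → ZMod 2 × ZMod 2)

/-- The operator `(-1)^ε P_1 ⊗ ⋯ ⊗ P_n` described by a signed Pauli. -/
noncomputable def SignedPauli.toMatrix {n : ℕ} (g : SignedPauli n) :
    Matrix (Bits n) (Bits n) ℂ :=
  Matrix.of fun x y => (-1) ^ g.1.val * ∏ k, pauli (g.2 k).1 (g.2 k).2 (x k) (y k)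

/-- `ψ` is an `n`-qubit stabilizer state: a unit vector such that exactly `2 ^ n` of the signed
Pauli operators fix it. (These operators then form a commuting group.) -/
def IsStabilizerState {n : ℕ} (ψ : Bits n → ℂ) : Prop :=
  ∑ x, ‖ψ x‖ ^ 2 = 1 ∧
    {g : SignedPauli n | g.toMatrix.mulVec ψ = ψ}.ncard = 2 ^ n

/-- The list of signed Paulis `g` identifies `ψ`: up to a scalar, `ψ` is the only vector fixed by
all of them. -/
def Identifies {n : ℕ} (g : Fin n → SignedPauli n) (ψ : Bits n → ℂ) : Prop :=
  (∀ j, (g j).toMatrix.mulVec ψ = ψ) ∧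
    ∀ φ : Bits n → ℂ, (∀ j, (g j).toMatrix.mulVec φ = φ) → ∃ c : ℂ, φ = c • ψ

/-! ### Measurements on two `n`-qubit registers -/

/-- Vectors of two `n`-qubit registers. -/
abbrev TwoReg (n : ℕ) : Type := Bits n → Bits n → ℂ

/-- Amplitude at `|x⟩|y⟩` of the Bell state `|σ_{ab}⟩ = vec(σ_{ab}) / √2`. -/
noncomputable def bellVec (a b x y : ZMod 2) : ℂ := sigma a b x y / (Real.sqrt 2 : ℂ)

/-- The projector `|σ_{ab}⟩⟨σ_{ab}|` applied to the `i`-th qubits of the two registers. -/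
noncomputable def bellProj {n : ℕ} (i : Fin n) (a b : ZMod 2) (v : TwoReg n) : TwoReg n :=
  fun x y => bellVec a b (x i) (y i) *
    ∑ c, ∑ d, (starRingEnd ℂ) (bellVec a b c d) *
      v (Function.update x i c) (Function.update y i d)

/-- The projector `(I + (-1)^e P) / 2`, where `P = pauli a b`, applied to the `i`-th qubit of the
first register: the projector onto the eigenspace of `P` with eigenvalue `(-1)^e`. -/
noncomputable def pauliProj {n : ℕ} (i : Fin n) (a b e : ZMod 2) (v : TwoReg n) : TwoReg n :=
  fun x y => (v x y + (-1) ^ e.val *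
    ∑ c, pauli a b (x i) c * v (Function.update x i c) y) / 2

/-! ### The machine: a random access machine that controls two quantum registers -/

/-- The memory cell `A[row, col]` of the bit array with number `arr`; `row` and `col` are the
names of the index registers that hold the two indices. -/
structure BitRef where
  arr : ℕ
  row : ℕ
  col : ℕ

/-- Programs. Register and array names are part of the program text, so a program is a finite
object that does not depend on the number of qubits. Index registers only change by being
cleared, copied, incremented, or used as loop counters, hence never exceed the number of qubits
plus the number of steps made. -/
inductive Cmd : Type
  /-- `c` followed by `d` -/
  | seq (c d : Cmd)
  /-- do nothing -/
  | skip
  /-- `r := 0` -/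
  | zero (r : ℕ)
  /-- `r := r'` -/
  | copy (r r' : ℕ)
  /-- `r := r + 1` -/
  | inc (r : ℕ)
  /-- if `r < r'` then `c` else `d` -/
  | ifLt (r r' : ℕ) (c d : Cmd)
  /-- for `i` from `0` to `r - 1` do `c`; the bound is read once, at the start -/
  | forLoop (i r : ℕ) (c : Cmd)
  /-- write a constant bit into a memory cell -/
  | setBit (p : BitRef) (b : ZMod 2)
  /-- `p := p ⊕ q` -/
  | xorBit (p q : BitRef)
  /-- if the bit `p` is `1` then `c` else `d` -/
  | ifBit (p : BitRef) (c d : Cmd)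
  /-- discard the contents of both quantum registers, then put a fresh copy of the unknown
  state into the first one and `|0…0⟩` into the second one -/
  | loadOne
  /-- discard the contents of both quantum registers, then put a fresh copy of the unknown
  state into each -/
  | loadTwo
  /-- measure the pair formed by the `i`-th qubits of the two registers in the Bell basis (`i` is
  held by the index register `i`), and write the two outcome bits into `p` and then `q` -/
  | bell (i : ℕ) (p q : BitRef)
  /-- measure the `i`-th qubit of the first register in the eigenbasis of the Pauli matrix
  `pauli a b`, and write `e` into `p` if the eigenvalue found is `(-1)^e` -/
  | meas (a b : ZMod 2) (i : ℕ) (p : BitRef)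

/-- A branch of a run of the machine with `n`-qubit registers. -/
structure Config (n : ℕ) where
  /-- index registers -/
  reg : ℕ → ℕ
  /-- bit arrays -/
  bit : ℕ × ℕ × ℕ → ZMod 2
  /-- steps made so far -/
  time : ℕ
  /-- copies of the unknown state used so far -/
  copies : ℕ
  /-- the probability of all measurement outcomes obtained before the last load -/
  prob : ℝ
  /-- the unnormalized vector of the two registers: its squared norm is the probability of the
  outcomes obtained since the last load -/
  vec : TwoReg n

namespace Config

variable {n : ℕ}

/-- The probability of a branch (Born's rule). -/
noncomputable def weight (s : Config n) : ℝ := s.prob * ∑ x, ∑ y, ‖s.vec x y‖ ^ 2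

/-- Count `k` steps. -/
def tick (s : Config n) (k : ℕ) : Config n := { s with time := s.time + k }

/-- Write an index register. -/
def setReg (s : Config n) (r k : ℕ) : Config n := { s with reg := Function.update s.reg r k }

/-- The address of a memory cell. -/
def addr (s : Config n) (p : BitRef) : ℕ × ℕ × ℕ := (p.arr, s.reg p.row, s.reg p.col)

/-- Read a memory cell. -/
def getBit (s : Config n) (p : BitRef) : ZMod 2 := s.bit (s.addr p)

/-- Write a memory cell. -/
def setBit (s : Config n) (p : BitRef) (b : ZMod 2) : Config n :=
  { s with bit := Function.update s.bit (s.addr p) b }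

/-- Replace the contents of the quantum registers by the product state `u ⊗ w`, using `k` copies
of the unknown state. -/
noncomputable def load (s : Config n) (u w : Bits n → ℂ) (k : ℕ) : Config n :=
  { s with prob := s.weight, vec := fun x y => u x * w y, copies := s.copies + k }

/-- The initial configuration: index register `0` holds `n`, everything else is `0`. -/
noncomputable def init (n : ℕ) : Config n where
  reg := Function.update (fun _ => 0) 0 n
  bit := fun _ => 0
  time := 0
  copies := 0
  prob := 1
  vec := fun x y => if x = 0 ∧ y = 0 then 1 else 0

/-- The output: the bits of the `j`-th signed Pauli operator (`j < n`) are in row `j` of array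
`0`, two columns per qubit, and its sign bit is in row `j`, column `0` of array `1`. -/
def output (s : Config n) (j : Fin n) : SignedPauli n :=
  (s.bit (1, j, 0), fun k => (s.bit (0, j, 2 * k), s.bit (0, j, 2 * k + 1)))

end Config

/-- Execution of a program with access to copies of `ψ`: the collection of all branches of the run,
one for each sequence of measurement outcomes. Every elementary operation, every test and every
loop iteration is one step; loading the quantum registers is one step and a further one for each
of the `2 * n` qubits. Measuring a qubit that does not exist has no effect. -/
noncomputable def exec {n : ℕ} (ψ : Bits n → ℂ) : Cmd → Config n → Multiset (Config n)
  | .seq c d, s => (exec ψ c s).bind (exec ψ d)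
  | .skip, s => {s.tick 1}
  | .zero r, s => {(s.tick 1).setReg r 0}
  | .copy r r', s => {(s.tick 1).setReg r (s.reg r')}
  | .inc r, s => {(s.tick 1).setReg r (s.reg r + 1)}
  | .ifLt r r' c d, s =>
      if s.reg r < s.reg r' then exec ψ c (s.tick 1) else exec ψ d (s.tick 1)
  | .forLoop i r c, s =>
      (List.range (s.reg r)).foldl
        (fun S k => S.bind fun s' => exec ψ c ((s'.tick 1).setReg i k)) {s.tick 1}
  | .setBit p b, s => {(s.tick 1).setBit p b}
  | .xorBit p q, s => {(s.tick 1).setBit p (s.getBit p + s.getBit q)}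
  | .ifBit p c d, s =>
      if s.getBit p = 1 then exec ψ c (s.tick 1) else exec ψ d (s.tick 1)
  | .loadOne, s => {(s.tick (2 * n + 1)).load ψ (fun y => if y = 0 then 1 else 0) 1}
  | .loadTwo, s => {(s.tick (2 * n + 1)).load ψ ψ 2}
  | .bell i p q, s =>
      if h : s.reg i < n then
        (Finset.univ : Finset (ZMod 2 × ZMod 2)).val.map fun r =>
          { ((s.tick 1).setBit p r.1).setBit q r.2 with
            vec := bellProj ⟨s.reg i, h⟩ r.1 r.2 s.vec }
      else {s.tick 1}
  | .meas a b i p, s =>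
      if h : s.reg i < n then
        (Finset.univ : Finset (ZMod 2)).val.map fun e =>
          { (s.tick 1).setBit p e with vec := pauliProj ⟨s.reg i, h⟩ a b e s.vec }
      else {s.tick 1}

/-- All branches of the run of a program on copies of `ψ`. -/
noncomputable def runs {n : ℕ} (P : Cmd) (ψ : Bits n → ℂ) : Multiset (Config n) :=
  exec ψ P (Config.init n)

open Classical in
/-- The probability that the output of the program identifies `ψ`. -/
noncomputable def successProb {n : ℕ} (P : Cmd) (ψ : Bits n → ℂ) : ℝ :=
  ((runs P ψ).map fun s => if Identifies s.output ψ then s.weight else 0).sum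

end BellLearning

/-! Let `T` be the set of Pauli labels, in 𝔽₂^(2n), whose operators have ψ as an eigenvector. It is
a subspace with 2^n elements, so it has dimension n. The algorithm finds a basis of `T` by Bell
sampling and then one sign for each basis vector.

Structure of stabilizer states. The Pauli coefficients of |ψ⟩⟨ψ| have total squared modulus 2^n, and
the 2^n elements of `T` already contribute 1 each, so all other coefficients vanish. Hence |ψ⟩⟨ψ| is
a combination of its stabilizers, ψ is determined by their eigenvalues
(`exists_eq_smul_of_eigenvalues`), and a Pauli operator commuting with all of `T` lies in `T`
(`mem_stabilizerSpace_of_sympSign`).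

Bell sampling. Up to normalization the amplitude of outcome r on ψ ⊗ ψ is the bilinear form ψᵀ σ̄_r
ψ. If σ_g ψ = cψ, replacing ψ by σ_g ψ in both slots multiplies the form by c², and also by the
commutation sign of g and r. So every possible outcome r has the same sign c² against g, and the sum
of two possible outcomes commutes with `T`, hence lies in `T` (`add_mem_stabilizerSpace`). By
Cauchy–Schwarz each outcome has probability at most 2^(-n). These two facts suffice; the exact
distribution of the outcomes is not needed.

Probability. One sample is kept as an offset and 2n further samples are added to it, each sum being
fed to an incremental Gaussian elimination. If the rank is d, the sum lies in the current span with
probability at most 2^d / 2^n, and therefore the expectation of the potential 2^(n-d) - 1 is at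
least halved by each sample (`hyperplanes_step`, `expect_learnRow_le`). After 2n samples it is at
most (2^n - 1) / 4^n ≤ 2^(-n). The potential is at least 1 whenever the rank is below n, so it
bounds the probability of failure.

Signs. For each basis vector a fresh copy is measured qubit by qubit in the bases that the vector
prescribes. The measurements commute with the full Pauli operator, so the parity of the outcomes is
its eigenvalue sign on ψ with certainty (`signLoop_spec`, `findSign_spec`).

The rest is a small program logic for the machine: frame rules, loop invariants, conservation of
probability, weighted expectations with a supermartingale rule for loops, and static resource
bounds. -/

namespace BellLearning

open Matrix

/-! ### Tensor products of matrices -/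

section Tensor

variable {n : ℕ} {ι κ μ : Type*}

/-- The matrix `A 0 ⊗ ⋯ ⊗ A (n - 1)`. -/
def tensor (A : Fin n → Matrix ι κ ℂ) : Matrix (Fin n → ι) (Fin n → κ) ℂ :=
  Matrix.of fun x y => ∏ k, A k (x k) (y k)

theorem tensor_apply (A : Fin n → Matrix ι κ ℂ) (x : Fin n → ι) (y : Fin n → κ) :
    tensor A x y = ∏ k, A k (x k) (y k) := rfl

theorem tensor_mul [Fintype κ] (A : Fin n → Matrix ι κ ℂ) (B : Fin n → Matrix κ μ ℂ) :
    tensor A * tensor B = tensor fun k => A k * B k := by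
  classical
  ext x y
  simp only [Matrix.mul_apply, tensor_apply, ← Finset.prod_mul_distrib]
  rw [Finset.prod_univ_sum, Fintype.piFinset_univ]

theorem tensor_one [DecidableEq ι] : tensor (fun _ : Fin n => (1 : Matrix ι ι ℂ)) = 1 := by
  ext x y
  simp only [tensor_apply, Matrix.one_apply]
  by_cases h : x = y
  · simp [h]
  · obtain ⟨k, hk⟩ := Function.ne_iff.mp h
    rw [if_neg h]
    exact Finset.prod_eq_zero (Finset.mem_univ k) (if_neg hk)

theorem tensor_smul (c : Fin n → ℂ) (A : Fin n → Matrix ι κ ℂ) :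
    tensor (fun k => c k • A k) = (∏ k, c k) • tensor A := by
  ext x y
  simp [tensor_apply, Finset.prod_mul_distrib]

theorem tensor_transpose (A : Fin n → Matrix ι κ ℂ) :
    (tensor A)ᵀ = tensor fun k => (A k)ᵀ := rfl

theorem tensor_conjTranspose (A : Fin n → Matrix ι κ ℂ) :
    (tensor A)ᴴ = tensor fun k => (A k)ᴴ := by
  ext x y
  simp [tensor_apply, Matrix.conjTranspose_apply]

/-- Terms at labels that differ from `x` away from `i` vanish because an identity factor contributes
0. This links the coordinate formulas for one-qubit measurements with matrices on all qubits. -/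
theorem tensor_update_one_mulVec [Fintype ι] [DecidableEq ι] (i : Fin n) (A : Matrix ι ι ℂ)
    (w : (Fin n → ι) → ℂ) (x : Fin n → ι) :
    (tensor (Function.update 1 i A) *ᵥ w) x = ∑ c, A (x i) c * w (Function.update x i c) := by
  rw [Matrix.mulVec, dotProduct]
  symm
  apply Finset.sum_of_injOn (fun c => Function.update x i c)
  · intro c _ d _ h
    exact Function.update_injective x i h
  · simp
  · intro y _ hy
    have : ∃ k, k ≠ i ∧ y k ≠ x k := by
      by_contra! h
      apply hy
      refine ⟨y i, by simp, ?_⟩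
      ext k
      by_cases hk : k = i
      · subst hk; simp
      · simp [hk, h k hk]
    obtain ⟨k, hk, hne⟩ := this
    rw [tensor_apply, Finset.prod_eq_zero (Finset.mem_univ k), zero_mul]
    simp [hk, hne.symm]
  · intro c _
    rw [tensor_apply, Finset.prod_eq_single i]
    · simp
    · intro k _ hk
      simp [hk]
    · simp

theorem star_dotProduct_self_eq_sum_norm_sq [Fintype ι] (u : ι → ℂ) :
    star u ⬝ᵥ u = ((∑ x, ‖u x‖ ^ 2 : ℝ) : ℂ) := by
  simp [dotProduct, ← Complex.normSq_eq_conj_mul_self, Complex.normSq_eq_norm_sq]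

theorem sum_norm_sq_mulVec_of_conjTranspose_mul_self [Fintype ι] [Fintype κ] [DecidableEq κ]
    {A : Matrix ι κ ℂ}
    (hA : Aᴴ * A = 1) (w : κ → ℂ) : ∑ x, ‖(A *ᵥ w) x‖ ^ 2 = ∑ x, ‖w x‖ ^ 2 := by
  have key : star (A *ᵥ w) ⬝ᵥ (A *ᵥ w) = star w ⬝ᵥ w := by
    rw [star_mulVec, dotProduct_mulVec, vecMul_vecMul, hA, vecMul_one]
  rw [star_dotProduct_self_eq_sum_norm_sq, star_dotProduct_self_eq_sum_norm_sq] at key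
  exact_mod_cast key

end Tensor

/-! ### One-qubit identities -/

theorem sum_zmod_two {M : Type*} [AddCommMonoid M] (f : ZMod 2 → M) : ∑ x, f x = f 0 + f 1 :=
  Fin.sum_univ_two f

theorem forall_zmod_two {p : ZMod 2 → Prop} : (∀ x, p x) ↔ p 0 ∧ p 1 := Fin.forall_fin_two

theorem zmod_two_eq_zero_or_one (a : ZMod 2) : a = 0 ∨ a = 1 := by
  revert a; decide

theorem one_add_one_zmod_two : (1 + 1 : ZMod 2) = 0 := rfl

theorem val_one_zmod_two : (1 : ZMod 2).val = 1 := rfl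

theorem neg_one_pow_val_add (a b : ZMod 2) :
    (-1 : ℂ) ^ (a + b).val = (-1) ^ a.val * (-1) ^ b.val := by
  revert a b
  simp [forall_zmod_two, one_add_one_zmod_two, val_one_zmod_two]

theorem neg_one_pow_val_mul_self (a : ZMod 2) : (-1 : ℂ) ^ a.val * (-1) ^ a.val = 1 := by
  rw [← mul_pow]; simp

theorem sigma_mul (h g : ZMod 2 × ZMod 2) :
    sigma h.1 h.2 * sigma g.1 g.2 = (-1 : ℂ) ^ (h.2 * g.1).val •
      sigma (h + g).1 (h + g).2 := by
  obtain ⟨a, b⟩ := h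
  obtain ⟨c, d⟩ := g
  ext x y
  revert a b c d x y
  simp [forall_zmod_two, sigma, Matrix.mul_apply, sum_zmod_two, one_add_one_zmod_two,
    val_one_zmod_two]

theorem sigma_zero : sigma 0 0 = 1 := by
  ext x y
  revert x y
  simp [forall_zmod_two, sigma, Matrix.one_apply, one_add_one_zmod_two]

theorem sigma_conjTranspose_mul_self (a b : ZMod 2) : (sigma a b)ᴴ * sigma a b = 1 := by
  ext x y
  revert a b x y
  simp [forall_zmod_two, sigma, Matrix.mul_apply, sum_zmod_two, one_add_one_zmod_two,
    val_one_zmod_two, Matrix.one_apply]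

/-- Congruence by `σ_h` multiplies the complex conjugate of `σ_r` by a sign. -/
theorem sigma_transpose_mul_star_mul (h r : ZMod 2 × ZMod 2) :
    (sigma h.1 h.2)ᵀ * (sigma r.1 r.2).map (starRingEnd ℂ) * sigma h.1 h.2 =
      (-1 : ℂ) ^ (h.1 * r.2 + h.2 * r.1).val •
        (sigma r.1 r.2).map (starRingEnd ℂ) := by
  obtain ⟨a, b⟩ := h
  obtain ⟨c, d⟩ := r
  ext x y
  revert a b c d x y
  simp [forall_zmod_two, sigma, Matrix.mul_apply, sum_zmod_two, one_add_one_zmod_two,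
    val_one_zmod_two]

/-- The phase that makes `σ_h` Hermitian. -/
noncomputable def phase (h : ZMod 2 × ZMod 2) : ℂ := if h.1 = 1 ∧ h.2 = 1 then -Complex.I else 1

theorem pauli_eq_phase_smul (h : ZMod 2 × ZMod 2) : pauli h.1 h.2 = phase h • sigma h.1 h.2 := rfl

theorem phase_ne_zero (h : ZMod 2 × ZMod 2) : phase h ≠ 0 := by
  unfold phase; split_ifs <;> simp

theorem pauli_mul_self (a b : ZMod 2) : pauli a b * pauli a b = 1 := by
  ext x y
  revert a b x y
  simp [forall_zmod_two, pauli, sigma, Matrix.mul_apply, sum_zmod_two, one_add_one_zmod_two,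
    val_one_zmod_two, Matrix.one_apply]

theorem pauli_conjTranspose (a b : ZMod 2) : (pauli a b)ᴴ = pauli a b := by
  ext x y
  revert a b x y
  simp [forall_zmod_two, pauli, sigma, one_add_one_zmod_two, val_one_zmod_two]

theorem sqrt_two_mul_self : (Real.sqrt 2 : ℂ) * (Real.sqrt 2 : ℂ) = 2 := by
  rw [← Complex.ofReal_mul, Real.mul_self_sqrt (by norm_num)]; norm_num

/-- The unitary matrix of the change to the Bell basis of two qubits. -/
noncomputable def bellMatrix : Matrix (ZMod 2 × ZMod 2) (ZMod 2 × ZMod 2) ℂ :=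
  Matrix.of fun r p => (starRingEnd ℂ) (bellVec r.1 r.2 p.1 p.2)

theorem bellVec_mul_conj (a b c d x y : ZMod 2) :
    bellVec a b x y * (starRingEnd ℂ) (bellVec c d x y) =
      sigma a b x y * (starRingEnd ℂ) (sigma c d x y) / 2 := by
  rw [bellVec, bellVec, map_div₀, Complex.conj_ofReal, div_mul_div_comm, sqrt_two_mul_self]

theorem bellMatrix_mul_conjTranspose : bellMatrix * bellMatrixᴴ = 1 := by
  ext ⟨a, b⟩ ⟨c, d⟩
  simp only [Matrix.mul_apply, bellMatrix, Matrix.conjTranspose_apply, Matrix.of_apply,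
    Fintype.sum_prod_type, Matrix.one_apply, RCLike.star_def, Complex.conj_conj]
  simp only [mul_comm ((starRingEnd ℂ) _), bellVec_mul_conj]
  revert a b c d
  simp [forall_zmod_two, sigma, sum_zmod_two, one_add_one_zmod_two, val_one_zmod_two]
  norm_num

theorem bellMatrix_conjTranspose_mul : bellMatrixᴴ * bellMatrix = 1 :=
  mul_eq_one_comm.mp bellMatrix_mul_conjTranspose

variable {n : ℕ}

/-! ### Pauli operators and their expansions -/

/-- Two bits for each of `n` qubits. -/
abbrev PauliBits (n : ℕ) : Type := Fin n → ZMod 2 × ZMod 2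

/-- The operator `σ_{h 0} ⊗ ⋯ ⊗ σ_{h (n - 1)}`. -/
noncomputable def sigmaOp (h : PauliBits n) : Matrix (Bits n) (Bits n) ℂ :=
  tensor fun k => sigma (h k).1 (h k).2

/-- The sign `(-1)^[h, g]` where `[h, g]` is the symplectic product. -/
noncomputable def sympSign (h g : PauliBits n) : ℂ :=
  ∏ k, (-1) ^ ((h k).1 * (g k).2 + (h k).2 * (g k).1).val

theorem sympSign_add_right (h g g' : PauliBits n) :
    sympSign h (g + g') = sympSign h g * sympSign h g' := by
  simp only [sympSign, ← Finset.prod_mul_distrib, ← neg_one_pow_val_add]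
  refine Finset.prod_congr rfl fun k _ => ?_
  congr 2
  simp only [Pi.add_apply, Prod.fst_add, Prod.snd_add]
  ring

theorem sympSign_mul_self (h g : PauliBits n) : sympSign h g * sympSign h g = 1 := by
  simp only [sympSign, ← Finset.prod_mul_distrib, neg_one_pow_val_mul_self,
    Finset.prod_const_one]

theorem sigmaOp_mul (h g : PauliBits n) :
    sigmaOp h * sigmaOp g =
      (∏ k, (-1 : ℂ) ^ ((h k).2 * (g k).1).val) • sigmaOp (h + g) := by
  rw [sigmaOp, sigmaOp, tensor_mul]
  simp_rw [sigma_mul]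
  rw [tensor_smul]
  rfl

theorem sigmaOp_zero : sigmaOp (0 : PauliBits n) = 1 := by
  simp only [sigmaOp, Pi.zero_apply, Prod.fst_zero, Prod.snd_zero, sigma_zero, tensor_one]

/-- The operator of a sum is, up to sign, the product of the operators. The eigenvalue is explicit
and independent of `w`, so the same value serves two different vectors in
`identifies_of_linearIndependent`. -/
theorem sigmaOp_add_mulVec {h g : PauliBits n} {w : Bits n → ℂ} {c d : ℂ}
    (hc : sigmaOp h *ᵥ w = c • w) (hd : sigmaOp g *ᵥ w = d • w) :
    sigmaOp (h + g) *ᵥ w =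
      ((∏ k, (-1 : ℂ) ^ ((h k).2 * (g k).1).val)⁻¹ * (c * d)) • w := by
  have hne : (∏ k, (-1 : ℂ) ^ ((h k).2 * (g k).1).val) ≠ 0 :=
    Finset.prod_ne_zero_iff.mpr fun k _ => pow_ne_zero _ (by norm_num)
  have h1 : (sigmaOp h * sigmaOp g) *ᵥ w = (c * d) • w := by
    rw [← mulVec_mulVec, hd, mulVec_smul, hc, smul_smul, mul_comm]
  rw [sigmaOp_mul, smul_mulVec] at h1
  rw [mul_smul, ← h1, inv_smul_smul₀ hne]

theorem sigmaOp_mul_comm (h g : PauliBits n) :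
    sigmaOp h * sigmaOp g = sympSign h g • (sigmaOp g * sigmaOp h) := by
  rw [sigmaOp_mul, sigmaOp_mul, smul_smul, add_comm g h, sympSign, ← Finset.prod_mul_distrib]
  congr 1
  refine Finset.prod_congr rfl fun k _ => ?_
  rw [neg_one_pow_val_add, mul_comm (g k).2, mul_right_comm, neg_one_pow_val_mul_self, one_mul]

theorem sigmaOp_conjTranspose_mul_self (h : PauliBits n) : (sigmaOp h)ᴴ * sigmaOp h = 1 := by
  rw [sigmaOp, tensor_conjTranspose, tensor_mul]
  simp only [sigma_conjTranspose_mul_self, tensor_one]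

/-- A transpose appears, not an adjoint, because Bell sampling on ψ ⊗ ψ evaluates the bilinear form
ψᵀ σ̄_r ψ; applying σ_h to both copies acts on its matrix by this congruence. -/
theorem sigmaOp_transpose_mul_star_mul (h r : PauliBits n) :
    (sigmaOp h)ᵀ * (sigmaOp r).map (starRingEnd ℂ) * sigmaOp h =
      sympSign h r • (sigmaOp r).map (starRingEnd ℂ) := by
  have hmap : (sigmaOp r).map (starRingEnd ℂ) =
      tensor fun k => (sigma (r k).1 (r k).2).map (starRingEnd ℂ) := by
    ext x y
    simp [sigmaOp, tensor_apply]
  rw [hmap, sigmaOp, tensor_transpose, tensor_mul, tensor_mul]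
  simp_rw [sigma_transpose_mul_star_mul]
  rw [tensor_smul]
  rfl

/-- The squared norm of a vector of two registers. -/
noncomputable def normSq (v : TwoReg n) : ℝ := ∑ x, ∑ y, ‖v x y‖ ^ 2

/-- A vector of two registers as a vector of `n` pairs of qubits. -/
def pack (v : TwoReg n) (p : PauliBits n) : ℂ := v (fun k => (p k).1) fun k => (p k).2

theorem sum_pairs {M : Type*} [AddCommMonoid M] (f : Bits n → Bits n → M) :
    ∑ p : PauliBits n, f (fun k => (p k).1) (fun k => (p k).2) = ∑ x, ∑ y, f x y := by
  rw [← Fintype.sum_prod_type']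
  exact Equiv.sum_comp (Equiv.arrowProdEquivProdArrow (Fin n) (fun _ => ZMod 2)
    (fun _ => ZMod 2)) fun q => f q.1 q.2

/-- The amplitude of `v` at the product of the Bell states `|σ_{r k}⟩`. -/
noncomputable def bellAmp (r : PauliBits n) (v : TwoReg n) : ℂ :=
  (tensor (fun _ => bellMatrix) *ᵥ pack v) r

/-- Parseval for the Bell basis: a tensor power of a unitary is unitary. -/
theorem sum_norm_sq_bellAmp (v : TwoReg n) : ∑ r, ‖bellAmp r v‖ ^ 2 = normSq v := by
  have h : (tensor fun _ : Fin n => bellMatrix)ᴴ * tensor (fun _ => bellMatrix) = 1 := by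
    rw [tensor_conjTranspose, tensor_mul]
    simp only [bellMatrix_conjTranspose_mul, tensor_one]
  rw [normSq, ← sum_pairs fun x y => ‖v x y‖ ^ 2]
  exact sum_norm_sq_mulVec_of_conjTranspose_mul_self h (pack v)

/-- The Hilbert–Schmidt product of `σ_r` and `v`. -/
noncomputable def pauliCoeff (r : PauliBits n) (v : TwoReg n) : ℂ :=
  ∑ x, ∑ y, (starRingEnd ℂ) (sigmaOp r x y) * v x y

theorem bellAmp_eq (r : PauliBits n) (v : TwoReg n) :
    bellAmp r v = ((Real.sqrt 2 : ℂ) ^ n)⁻¹ * pauliCoeff r v := by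
  rw [bellAmp, pauliCoeff, ← sum_pairs fun x y => (starRingEnd ℂ) (sigmaOp r x y) * v x y,
    Matrix.mulVec, dotProduct, Finset.mul_sum]
  refine Finset.sum_congr rfl fun p _ => ?_
  rw [← mul_assoc]
  congr 1
  simp [tensor_apply, bellMatrix, bellVec, sigmaOp, div_eq_inv_mul, Finset.prod_mul_distrib]

theorem norm_sq_bellAmp (r : PauliBits n) (v : TwoReg n) :
    ‖bellAmp r v‖ ^ 2 = ‖pauliCoeff r v‖ ^ 2 / 2 ^ n := by
  rw [bellAmp_eq, norm_mul, mul_pow, norm_inv, norm_pow, Complex.norm_real, Real.norm_eq_abs,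
    abs_of_nonneg (Real.sqrt_nonneg 2), inv_pow, ← pow_mul, mul_comm n 2, pow_mul,
    Real.sq_sqrt (by norm_num)]
  ring

theorem sum_norm_sq_pauliCoeff (v : TwoReg n) :
    ∑ r, ‖pauliCoeff r v‖ ^ 2 = 2 ^ n * normSq v := by
  rw [← sum_norm_sq_bellAmp]
  simp_rw [norm_sq_bellAmp]
  rw [← Finset.sum_div]
  field_simp

/-- Expansion in the Pauli basis. -/
theorem sum_pauliCoeff_mul_sigmaOp (v : TwoReg n) (x y : Bits n) :
    ∑ r, pauliCoeff r v * sigmaOp r x y = 2 ^ n * v x y := by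
  have hU : (tensor fun _ : Fin n => bellMatrix)ᴴ * tensor (fun _ => bellMatrix) = 1 := by
    rw [tensor_conjTranspose, tensor_mul]
    simp only [bellMatrix_conjTranspose_mul, tensor_one]
  have h : ((tensor fun _ : Fin n => bellMatrix)ᴴ *ᵥ
      (tensor (fun _ => bellMatrix) *ᵥ pack v)) (fun k => (x k, y k)) = v x y := by
    rw [mulVec_mulVec, hU, one_mulVec]; rfl
  have h2 : (Real.sqrt 2 : ℂ) ^ n * (Real.sqrt 2 : ℂ) ^ n = 2 ^ n := by
    rw [← mul_pow, sqrt_two_mul_self]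
  have h0 : (Real.sqrt 2 : ℂ) ^ n ≠ 0 := by
    intro h
    rw [h, mul_zero] at h2
    exact pow_ne_zero n two_ne_zero h2.symm
  rw [← h, ← h2, Matrix.mulVec, dotProduct, Finset.mul_sum]
  refine Finset.sum_congr rfl fun r _ => ?_
  change _ = _ * (_ * bellAmp r v)
  rw [bellAmp_eq]
  have : (tensor fun _ : Fin n => bellMatrix)ᴴ (fun k => (x k, y k)) r =
      ((Real.sqrt 2 : ℂ) ^ n)⁻¹ * sigmaOp r x y := by
    simp [tensor_apply, bellMatrix, bellVec, sigmaOp, div_eq_inv_mul, Finset.prod_mul_distrib]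
  rw [this]
  field_simp

/-- The coefficient is the inner product of ψ with σ_r ψ̄, and both are unit vectors, so
Cauchy–Schwarz applies. With `norm_sq_bellAmp`, no outcome of Bell sampling has probability above
2^(-n). -/
theorem norm_sq_pauliCoeff_self_le {ψ : Bits n → ℂ} (hψ : ∑ x, ‖ψ x‖ ^ 2 = 1)
    (r : PauliBits n) : ‖pauliCoeff r fun x y => ψ x * ψ y‖ ^ 2 ≤ 1 := by
  set w : Bits n → ℂ := sigmaOp r *ᵥ star ψ with hw
  have hwn : ∑ x, ‖w x‖ ^ 2 = 1 := by
    rw [hw, sum_norm_sq_mulVec_of_conjTranspose_mul_self (sigmaOp_conjTranspose_mul_self r)]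
    simpa using hψ
  have h1 : pauliCoeff r (fun x y => ψ x * ψ y) = ∑ x, ψ x * (starRingEnd ℂ) (w x) := by
    refine Finset.sum_congr rfl fun x _ => ?_
    simp only [hw, Matrix.mulVec, dotProduct, map_sum, Finset.mul_sum, map_mul, Pi.star_apply,
      RCLike.star_def, Complex.conj_conj]
    exact Finset.sum_congr rfl fun y _ => by ring
  have h2 : ‖pauliCoeff r fun x y => ψ x * ψ y‖ ≤ ∑ x, ‖ψ x‖ * ‖w x‖ := by
    rw [h1]
    refine (norm_sum_le _ _).trans_eq ?_
    simp
  have h3 := Finset.sum_mul_sq_le_sq_mul_sq Finset.univ (fun x => ‖ψ x‖) fun x => ‖w x‖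
  rw [hψ, hwn, one_mul] at h3
  exact (pow_le_pow_left₀ (norm_nonneg _) h2 2).trans h3

/-! ### Stabilizer states -/

/-- The Pauli operators, without signs, that have `ψ` as an eigenvector. -/
def stabilizerSpace (ψ : Bits n → ℂ) : Submodule (ZMod 2) (PauliBits n) where
  carrier := {h | ∃ c : ℂ, sigmaOp h *ᵥ ψ = c • ψ}
  zero_mem' := ⟨1, by simp [sigmaOp_zero]⟩
  add_mem' := by
    rintro h g ⟨c, hc⟩ ⟨d, hd⟩
    exact ⟨_, sigmaOp_add_mulVec hc hd⟩
  smul_mem' := by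
    rintro a h ⟨c, hc⟩
    rcases zmod_two_eq_zero_or_one a with rfl | rfl
    · exact ⟨1, by simp [sigmaOp_zero]⟩
    · exact ⟨c, by simpa using hc⟩

/-- The product of the phases that make the tensor factors of `σ_h` Hermitian. -/
noncomputable def totalPhase (h : PauliBits n) : ℂ := ∏ k, phase (h k)

theorem totalPhase_ne_zero (h : PauliBits n) : totalPhase h ≠ 0 :=
  Finset.prod_ne_zero_iff.mpr fun _ _ => phase_ne_zero _

theorem toMatrix_eq_smul_tensor (g : SignedPauli n) :
    g.toMatrix = (-1 : ℂ) ^ g.1.val • tensor fun k => pauli (g.2 k).1 (g.2 k).2 := by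
  ext x y
  simp [SignedPauli.toMatrix, tensor_apply]

theorem tensor_pauli_eq_smul_sigmaOp (h : PauliBits n) :
    (tensor fun k => pauli (h k).1 (h k).2) = totalPhase h • sigmaOp h := by
  simp_rw [pauli_eq_phase_smul]
  rw [tensor_smul]
  rfl

theorem tensor_pauli_mul_self (h : PauliBits n) :
    (tensor fun k => pauli (h k).1 (h k).2) * (tensor fun k => pauli (h k).1 (h k).2) = 1 := by
  rw [tensor_mul]
  simp only [pauli_mul_self, tensor_one]

theorem toMatrix_eq_smul_sigmaOp (g : SignedPauli n) :
    g.toMatrix = ((-1 : ℂ) ^ g.1.val * totalPhase g.2) • sigmaOp g.2 := by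
  rw [toMatrix_eq_smul_tensor, tensor_pauli_eq_smul_sigmaOp, smul_smul]

theorem ne_zero_of_sum_norm_sq {ψ : Bits n → ℂ} (hψ : ∑ x, ‖ψ x‖ ^ 2 = 1) : ψ ≠ 0 := by
  rintro rfl
  simp at hψ

theorem sq_eq_one_of_involution {ι : Type*} [Fintype ι] [DecidableEq ι] {A : Matrix ι ι ℂ}
    (hA : A * A = 1) {w : ι → ℂ} (hw : w ≠ 0) {c : ℂ} (h : A *ᵥ w = c • w) : c * c = 1 := by
  have h1 : (A * A) *ᵥ w = (c * c) • w := by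
    rw [← mulVec_mulVec, h, mulVec_smul, h, smul_smul]
  rw [hA, one_mulVec] at h1
  by_contra hc
  have : (1 - c * c) • w = 0 := by rw [sub_smul, ← h1, one_smul, sub_self]
  rcases smul_eq_zero.mp this with h2 | h2
  · exact hc (sub_eq_zero.mp h2).symm
  · exact hw h2

theorem exists_sign_of_mul_self_eq_one {c : ℂ} (h : c * c = 1) :
    ∃ e : ZMod 2, c = (-1) ^ e.val := by
  rcases mul_self_eq_one_iff.mp h with rfl | rfl
  · exact ⟨0, by simp⟩
  · exact ⟨1, by simp [val_one_zmod_two]⟩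

/-- A stabilized direction is stabilized with a sign. -/
theorem exists_sign_of_mem_stabilizerSpace {ψ : Bits n → ℂ} (hψ : ψ ≠ 0) {h : PauliBits n}
    (hh : h ∈ stabilizerSpace ψ) :
    ∃ e : ZMod 2, (tensor fun k => pauli (h k).1 (h k).2) *ᵥ ψ = (-1 : ℂ) ^ e.val • ψ := by
  obtain ⟨c, hc⟩ := hh
  have h1 : (tensor fun k => pauli (h k).1 (h k).2) *ᵥ ψ = (totalPhase h * c) • ψ := by
    rw [tensor_pauli_eq_smul_sigmaOp, smul_mulVec, hc, smul_smul]
  obtain ⟨e, he⟩ := exists_sign_of_mul_self_eq_one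
    (sq_eq_one_of_involution (tensor_pauli_mul_self h) hψ h1)
  exact ⟨e, by rw [h1, he]⟩

/-- Forgetting the sign is a bijection from the signed Paulis that fix ψ. It is injective because P
and -P cannot both fix a nonzero vector, and surjective because a Hermitian Pauli is an involution,
so its eigenvalues are ±1. -/
theorem card_stabilizerSpace {ψ : Bits n → ℂ} (hψ : IsStabilizerState ψ) :
    Nat.card (stabilizerSpace ψ) = 2 ^ n := by
  have h0 := ne_zero_of_sum_norm_sq hψ.1
  rw [← hψ.2]
  change Nat.card ((stabilizerSpace ψ : Set (PauliBits n))) = _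
  rw [Nat.card_coe_set_eq]
  symm
  refine Set.ncard_congr (fun g _ => g.2) ?_ ?_ ?_
  · intro g hg
    rw [Set.mem_ofPred_eq, toMatrix_eq_smul_sigmaOp, smul_mulVec] at hg
    have hne : (-1 : ℂ) ^ g.1.val * totalPhase g.2 ≠ 0 :=
      mul_ne_zero (pow_ne_zero _ (by norm_num)) (totalPhase_ne_zero _)
    refine ⟨((-1 : ℂ) ^ g.1.val * totalPhase g.2)⁻¹, ?_⟩
    conv_rhs => rw [← hg]
    rw [inv_smul_smul₀ hne]
  · rintro ⟨e, h⟩ ⟨e', h'⟩ hg hg' (rfl : h = h')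
    rw [Set.mem_ofPred_eq, toMatrix_eq_smul_tensor, smul_mulVec] at hg hg'
    congr 1
    set w := (tensor fun k => pauli (h k).1 (h k).2) *ᵥ ψ with hw
    have key : ∀ {a b : ZMod 2}, a = 0 → b = 1 → (-1 : ℂ) ^ a.val • w = ψ →
        (-1 : ℂ) ^ b.val • w = ψ → False := by
      rintro _ _ rfl rfl ha hb
      simp only [ZMod.val_zero, pow_zero, one_smul, val_one_zmod_two, pow_one] at ha hb
      rw [ha] at hb
      exact h0 (neg_eq_self.mp (by simpa using hb))
    rcases zmod_two_eq_zero_or_one e with he | he <;>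
      rcases zmod_two_eq_zero_or_one e' with he' | he'
    · rw [he, he']
    · exact (key he he' hg hg').elim
    · exact (key he' he hg' hg).elim
    · rw [he, he']
  · intro h hh
    obtain ⟨e, he⟩ := exists_sign_of_mem_stabilizerSpace h0 hh
    refine ⟨(e, h), ?_, rfl⟩
    rw [Set.mem_ofPred_eq, toMatrix_eq_smul_tensor, smul_mulVec, he, smul_smul,
      neg_one_pow_val_mul_self, one_smul]

theorem norm_eigenvalue_sigmaOp {ψ : Bits n → ℂ} (hψ : ∑ x, ‖ψ x‖ ^ 2 = 1) {h : PauliBits n}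
    {c : ℂ} (hc : sigmaOp h *ᵥ ψ = c • ψ) : ‖c‖ ^ 2 = 1 := by
  have := sum_norm_sq_mulVec_of_conjTranspose_mul_self (sigmaOp_conjTranspose_mul_self h) ψ
  rw [hc] at this
  simpa [mul_pow, ← Finset.mul_sum, hψ] using this

theorem pauliCoeff_density {ψ : Bits n → ℂ} (hψ : ∑ x, ‖ψ x‖ ^ 2 = 1) {h : PauliBits n}
    {c : ℂ} (hc : sigmaOp h *ᵥ ψ = c • ψ) :
    pauliCoeff h (fun x y => ψ x * (starRingEnd ℂ) (ψ y)) = (starRingEnd ℂ) c := by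
  have h1 : ∀ x, ∑ y, (starRingEnd ℂ) (sigmaOp h x y) * (ψ x * (starRingEnd ℂ) (ψ y)) =
      (starRingEnd ℂ) c * ((‖ψ x‖ ^ 2 : ℝ) : ℂ) := by
    intro x
    have := congrArg (starRingEnd ℂ) (congrFun hc x)
    simp only [Matrix.mulVec, dotProduct, map_sum, map_mul, Pi.smul_apply, smul_eq_mul] at this
    rw [← Complex.normSq_eq_norm_sq, Complex.normSq_eq_conj_mul_self, ← mul_assoc, ← this,
      Finset.sum_mul]
    exact Finset.sum_congr rfl fun y _ => by ring
  rw [pauliCoeff]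
  simp_rw [h1]
  rw [← Finset.mul_sum, ← Complex.ofReal_sum, hψ]
  simp

theorem normSq_density {ψ : Bits n → ℂ} (hψ : ∑ x, ‖ψ x‖ ^ 2 = 1) :
    normSq (fun x y => ψ x * (starRingEnd ℂ) (ψ y)) = 1 := by
  simp [normSq, mul_pow, ← Finset.mul_sum, hψ]

/-- Parseval leaves no room: the squared moduli add up to 2^n, and the 2^n elements of the
stabilizer account for 1 each. -/
theorem pauliCoeff_density_eq_zero {ψ : Bits n → ℂ} (hψ : IsStabilizerState ψ)
    {h : PauliBits n} (hh : h ∉ stabilizerSpace ψ) :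
    pauliCoeff h (fun x y => ψ x * (starRingEnd ℂ) (ψ y)) = 0 := by
  classical
  have htot := sum_norm_sq_pauliCoeff fun x y => ψ x * (starRingEnd ℂ) (ψ y)
  rw [normSq_density hψ.1, mul_one,
    ← Finset.sum_filter_add_sum_filter_not Finset.univ (· ∈ stabilizerSpace ψ)] at htot
  have h1 : ∑ r with r ∈ stabilizerSpace ψ,
      ‖pauliCoeff r fun x y => ψ x * (starRingEnd ℂ) (ψ y)‖ ^ 2 = 2 ^ n := by
    rw [Finset.sum_congr rfl (g := fun _ => (1 : ℝ))]
    · rw [Finset.sum_const, nsmul_eq_mul, mul_one]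
      have := card_stabilizerSpace hψ
      rw [Nat.card_eq_fintype_card, Fintype.card_subtype] at this
      rw [this]; norm_num
    · intro r hr
      obtain ⟨c, hc⟩ := (Finset.mem_filter.mp hr).2
      rw [pauliCoeff_density hψ.1 hc, RCLike.norm_conj, norm_eigenvalue_sigmaOp hψ.1 hc]
  rw [h1, add_eq_left, Finset.sum_eq_zero_iff_of_nonneg fun _ _ => by positivity] at htot
  simpa using htot h (by simp [hh])

/-- A stabilizer state is determined, up to a scalar, by the eigenvalues of its stabilizer. -/
theorem exists_eq_smul_of_eigenvalues {ψ φ : Bits n → ℂ} (hψ : IsStabilizerState ψ)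
    (hφ : ∀ (h : PauliBits n) (c : ℂ), sigmaOp h *ᵥ ψ = c • ψ → sigmaOp h *ᵥ φ = c • φ) :
    ∃ d : ℂ, φ = d • ψ := by
  classical
  -- The scalar is the inner product of ψ and φ; the claim becomes that |ψ⟩⟨ψ| fixes φ.
  refine ⟨∑ y, (starRingEnd ℂ) (ψ y) * φ y, ?_⟩
  ext x
  have key : (2 : ℂ) ^ n * (ψ x * ∑ y, (starRingEnd ℂ) (ψ y) * φ y) = 2 ^ n * φ x := by
    -- In the Pauli expansion of |ψ⟩⟨ψ| applied to φ, a stabilizer term carries c̄ from the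
    -- coefficient and c from φ, and |c|² = 1; all other terms vanish. The 2^n surviving terms are
    -- all equal to φ.
    have hmem : ∀ h : PauliBits n,
        pauliCoeff h (fun x y => ψ x * (starRingEnd ℂ) (ψ y)) * (sigmaOp h *ᵥ φ) x =
          if h ∈ stabilizerSpace ψ then φ x else 0 := by
      intro h
      split_ifs with hh
      · obtain ⟨c, hc⟩ := hh
        rw [pauliCoeff_density hψ.1 hc, hφ h c hc, Pi.smul_apply, smul_eq_mul, ← mul_assoc,
          ← Complex.normSq_eq_conj_mul_self, Complex.normSq_eq_norm_sq,
          norm_eigenvalue_sigmaOp hψ.1 hc]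
        simp
      · rw [pauliCoeff_density_eq_zero hψ hh, zero_mul]
    calc (2 : ℂ) ^ n * (ψ x * ∑ y, (starRingEnd ℂ) (ψ y) * φ y)
        = ∑ y, (2 ^ n * (ψ x * (starRingEnd ℂ) (ψ y))) * φ y := by
          rw [Finset.mul_sum, Finset.mul_sum]
          exact Finset.sum_congr rfl fun y _ => by ring
      _ = ∑ h, pauliCoeff h (fun x y => ψ x * (starRingEnd ℂ) (ψ y)) *
            (sigmaOp h *ᵥ φ) x := by
          simp_rw [← sum_pauliCoeff_mul_sigmaOp (fun x y => ψ x * (starRingEnd ℂ) (ψ y)) x,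
            Matrix.mulVec, dotProduct, Finset.mul_sum, Finset.sum_mul]
          rw [Finset.sum_comm]
          exact Finset.sum_congr rfl fun y _ => Finset.sum_congr rfl fun y _ => by ring
      _ = 2 ^ n * φ x := by
          simp_rw [hmem]
          rw [← Finset.sum_filter, Finset.sum_const, nsmul_eq_mul]
          have := card_stabilizerSpace hψ
          rw [Nat.card_eq_fintype_card, Fintype.card_subtype] at this
          rw [this]; norm_num
  have h2 : (2 : ℂ) ^ n ≠ 0 := pow_ne_zero _ (by norm_num)
  rw [← mul_left_cancel₀ h2 key, Pi.smul_apply, smul_eq_mul, mul_comm]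

/-- The stabilizer of a stabilizer state is a maximal set of commuting Pauli operators. -/
theorem mem_stabilizerSpace_of_sympSign {ψ : Bits n → ℂ} (hψ : IsStabilizerState ψ)
    {h : PauliBits n} (hh : ∀ g ∈ stabilizerSpace ψ, sympSign g h = 1) :
    h ∈ stabilizerSpace ψ := by
  -- Since σ_h commutes with the stabilizer, σ_h ψ has the same eigenvalues as ψ, so it is a
  -- multiple of ψ.
  obtain ⟨d, hd⟩ := exists_eq_smul_of_eigenvalues (φ := sigmaOp h *ᵥ ψ) hψ (by
    intro g c hc
    rw [mulVec_mulVec, sigmaOp_mul_comm, hh g ⟨c, hc⟩, one_smul, ← mulVec_mulVec, hc,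
      mulVec_smul])
  exact ⟨d, hd⟩

/-- The form ψᵀ σ̄_r ψ is evaluated at σ_g ψ in two ways: the eigenvalue equation gives the factor
c², the congruence by σ_g gives the commutation sign. The form is nonzero and cancels. What matters
is that c² does not depend on the outcome `r`. -/
theorem sympSign_eq_of_pauliCoeff_ne_zero {ψ : Bits n → ℂ} {r g : PauliBits n} {c : ℂ}
    (hr : pauliCoeff r (fun x y => ψ x * ψ y) ≠ 0) (hc : sigmaOp g *ᵥ ψ = c • ψ) :
    sympSign g r = c * c := by
  have hq : pauliCoeff r (fun x y => ψ x * ψ y) =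
      ψ ⬝ᵥ ((sigmaOp r).map (starRingEnd ℂ) *ᵥ ψ) := by
    simp only [pauliCoeff, dotProduct, Matrix.mulVec, Finset.mul_sum, Matrix.map_apply]
    exact Finset.sum_congr rfl fun x _ => Finset.sum_congr rfl fun y _ => by ring
  have h1 : (sigmaOp g *ᵥ ψ) ⬝ᵥ ((sigmaOp r).map (starRingEnd ℂ) *ᵥ (sigmaOp g *ᵥ ψ)) =
      sympSign g r * pauliCoeff r (fun x y => ψ x * ψ y) := by
    conv_lhs => lhs; rw [← vecMul_transpose]
    rw [← dotProduct_mulVec, mulVec_mulVec, mulVec_mulVec,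
      sigmaOp_transpose_mul_star_mul, smul_mulVec, dotProduct_smul, ← hq, smul_eq_mul]
  rw [hc, mulVec_smul, smul_dotProduct, dotProduct_smul, ← hq, smul_eq_mul, smul_eq_mul,
    ← mul_assoc] at h1
  exact (mul_right_cancel₀ hr h1).symm

/-- The sum of two outcomes of Bell sampling is in the stabilizer. -/
theorem add_mem_stabilizerSpace {ψ : Bits n → ℂ} (hψ : IsStabilizerState ψ)
    {r r' : PauliBits n} (hr : pauliCoeff r (fun x y => ψ x * ψ y) ≠ 0)
    (hr' : pauliCoeff r' (fun x y => ψ x * ψ y) ≠ 0) : r + r' ∈ stabilizerSpace ψ := by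
  refine mem_stabilizerSpace_of_sympSign hψ ?_
  rintro g ⟨c, hc⟩
  rw [sympSign_add_right, sympSign_eq_of_pauliCoeff_ne_zero hr' hc,
    ← sympSign_eq_of_pauliCoeff_ne_zero hr hc, sympSign_mul_self]

/-- Independent stabilizer elements with the right signs identify the state. -/
theorem identifies_of_linearIndependent {ψ : Bits n → ℂ} (hψ : IsStabilizerState ψ)
    (g : Fin n → SignedPauli n) (hg : ∀ j, (g j).toMatrix *ᵥ ψ = ψ)
    (hind : LinearIndependent (ZMod 2) fun j => (g j).2) : Identifies g ψ := by
  refine ⟨hg, fun φ hφ => exists_eq_smul_of_eigenvalues hψ ?_⟩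
  have h0 := ne_zero_of_sum_norm_sq hψ.1
  -- `W` collects the Pauli operators on which ψ and φ have a common eigenvalue. It lies in the
  -- stabilizer, of dimension n, and contains n independent vectors, so the two coincide.
  let W : Submodule (ZMod 2) (PauliBits n) :=
    { carrier := {h | ∃ c : ℂ, sigmaOp h *ᵥ ψ = c • ψ ∧ sigmaOp h *ᵥ φ = c • φ}
      zero_mem' := ⟨1, by simp [sigmaOp_zero]⟩
      add_mem' := by
        rintro h g ⟨c, hc, hc'⟩ ⟨d, hd, hd'⟩
        exact ⟨_, sigmaOp_add_mulVec hc hd, sigmaOp_add_mulVec hc' hd'⟩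
      smul_mem' := by
        rintro a h ⟨c, hc⟩
        rcases zmod_two_eq_zero_or_one a with rfl | rfl
        · exact ⟨1, by simp [sigmaOp_zero]⟩
        · exact ⟨c, by simpa using hc⟩ }
  have hWT : W ≤ stabilizerSpace ψ := fun h ⟨c, hc, _⟩ => ⟨c, hc⟩
  have hspan : Submodule.span (ZMod 2) (Set.range fun j => (g j).2) ≤ W := by
    rw [Submodule.span_le]
    rintro _ ⟨j, rfl⟩
    have key : ∀ w : Bits n → ℂ, (g j).toMatrix *ᵥ w = w → sigmaOp (g j).2 *ᵥ w =
        ((-1 : ℂ) ^ (g j).1.val * totalPhase (g j).2)⁻¹ • w := by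
      intro w hw
      rw [toMatrix_eq_smul_sigmaOp, smul_mulVec] at hw
      have hne : (-1 : ℂ) ^ (g j).1.val * totalPhase (g j).2 ≠ 0 :=
        mul_ne_zero (pow_ne_zero _ (by norm_num)) (totalPhase_ne_zero _)
      conv_rhs => rw [← hw]
      rw [inv_smul_smul₀ hne]
    exact ⟨_, key ψ (hg j), key φ (hφ j)⟩
  have hfin : Module.finrank (ZMod 2) (stabilizerSpace ψ) = n := by
    have h1 := card_stabilizerSpace hψ
    rw [Module.natCard_eq_pow_finrank (K := ZMod 2), Nat.card_zmod] at h1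
    exact Nat.pow_right_injective le_rfl h1
  have heq : W = stabilizerSpace ψ := by
    refine Submodule.eq_of_le_of_finrank_le hWT ?_
    rw [hfin]
    refine le_trans ?_ (Submodule.finrank_mono hspan)
    rw [finrank_span_eq_card hind, Fintype.card_fin]
  intro h c hc
  obtain ⟨c', hc1, hc2⟩ : h ∈ W := heq ▸ (⟨c, hc⟩ : h ∈ stabilizerSpace ψ)
  have : c = c' := smul_left_injective ℂ h0 (hc.symm.trans hc1)
  rw [this, hc2]

/-! ### Measurements -/

theorem pack_bellProj (i : Fin n) (a b : ZMod 2) (v : TwoReg n) :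
    pack (bellProj i a b v) = tensor (Function.update 1 i (Matrix.of fun p q =>
      bellVec a b p.1 p.2 * (starRingEnd ℂ) (bellVec a b q.1 q.2))) *ᵥ pack v := by
  ext p
  rw [tensor_update_one_mulVec]
  simp only [pack, bellProj, Matrix.of_apply, Fintype.sum_prod_type, Finset.mul_sum]
  refine Finset.sum_congr rfl fun c _ => Finset.sum_congr rfl fun d _ => ?_
  rw [mul_assoc]
  congr 3
  · ext k; by_cases hk : k = i
    · subst hk; simp
    · simp [hk]
  · ext k; by_cases hk : k = i
    · subst hk; simp
    · simp [hk]

/-- A Bell measurement keeps the amplitudes that agree with its outcome. -/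
theorem bellAmp_bellProj (r : PauliBits n) (i : Fin n) (a b : ZMod 2) (v : TwoReg n) :
    bellAmp r (bellProj i a b v) = if r i = (a, b) then bellAmp r v else 0 := by
  -- In the Bell basis the projector is diagonal: U P = D U, by orthonormality of the rows of U.
  have h1 : ∀ r q : ZMod 2 × ZMod 2, (bellMatrix * Matrix.of fun p q : ZMod 2 × ZMod 2 =>
      bellVec a b p.1 p.2 * (starRingEnd ℂ) (bellVec a b q.1 q.2)) r q =
        (Matrix.diagonal (fun s => if s = (a, b) then (1 : ℂ) else 0) * bellMatrix) r q := by
    intro r q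
    have := congrFun (congrFun bellMatrix_mul_conjTranspose r) (a, b)
    simp only [Matrix.mul_apply, bellMatrix, Matrix.conjTranspose_apply, Matrix.of_apply,
      RCLike.star_def, Complex.conj_conj] at this
    rw [Matrix.diagonal_mul, Matrix.mul_apply]
    simp only [bellMatrix, Matrix.of_apply, ← mul_assoc]
    rw [← Finset.sum_mul, this, Matrix.one_apply]
    split_ifs with h
    · rw [h]
    · simp
  have h2 : (tensor fun _ : Fin n => bellMatrix) *
      tensor (Function.update 1 i (Matrix.of fun p q : ZMod 2 × ZMod 2 =>
        bellVec a b p.1 p.2 * (starRingEnd ℂ) (bellVec a b q.1 q.2))) =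
      tensor (Function.update 1 i (Matrix.diagonal (fun s => if s = (a, b) then 1 else 0))) *
        tensor fun _ : Fin n => bellMatrix := by
    rw [tensor_mul, tensor_mul]
    congr 1
    funext k
    by_cases hk : k = i
    · subst hk
      simp only [Function.update_self]
      ext r q
      exact h1 r q
    · simp [hk]
  rw [bellAmp, pack_bellProj, mulVec_mulVec, h2, ← mulVec_mulVec, tensor_update_one_mulVec,
    Finset.sum_eq_single (r i)]
  · simp [bellAmp]
  · intro c _ hc
    rw [Matrix.diagonal_apply_ne _ hc.symm, zero_mul]
  · simp

/-- A Bell measurement does not change the total probability of a set of outcomes. -/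
theorem sum_bellAmp_bellProj (D : Finset (PauliBits n)) (i : Fin n) (v : TwoReg n) :
    ∑ q : ZMod 2 × ZMod 2, ∑ r ∈ D, ‖bellAmp r (bellProj i q.1 q.2 v)‖ ^ 2 =
      ∑ r ∈ D, ‖bellAmp r v‖ ^ 2 := by
  rw [Finset.sum_comm]
  refine Finset.sum_congr rfl fun r _ => ?_
  simp_rw [bellAmp_bellProj]
  rw [Finset.sum_eq_single (r i)]
  · simp
  · intro q _ hq
    simp [hq.symm]
  · simp

theorem sum_normSq_bellProj (i : Fin n) (v : TwoReg n) :
    ∑ q : ZMod 2 × ZMod 2, normSq (bellProj i q.1 q.2 v) = normSq v := by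
  simp_rw [← sum_norm_sq_bellAmp]
  exact sum_bellAmp_bellProj Finset.univ i v

/-- A matrix that acts on the first register. -/
noncomputable def onFirst (A : Matrix (Bits n) (Bits n) ℂ) (v : TwoReg n) : TwoReg n :=
  fun x y => (A *ᵥ fun x' => v x' y) x

theorem onFirst_onFirst (A B : Matrix (Bits n) (Bits n) ℂ) (v : TwoReg n) :
    onFirst A (onFirst B v) = onFirst (A * B) v := by
  funext x y
  exact congrFun (mulVec_mulVec (fun x' => v x' y) A B) x

theorem onFirst_add (A : Matrix (Bits n) (Bits n) ℂ) (v w : TwoReg n) :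
    onFirst A (v + w) = onFirst A v + onFirst A w := by
  funext x y
  exact congrFun (mulVec_add A (fun x' => v x' y) fun x' => w x' y) x

theorem onFirst_smul (A : Matrix (Bits n) (Bits n) ℂ) (c : ℂ) (v : TwoReg n) :
    onFirst A (c • v) = c • onFirst A v := by
  funext x y
  exact congrFun (mulVec_smul A c fun x' => v x' y) x

theorem onFirst_one (v : TwoReg n) : onFirst 1 v = v := by
  funext x y
  simp [onFirst]

theorem pauliProj_eq (i : Fin n) (a b e : ZMod 2) (v : TwoReg n) :
    pauliProj i a b e v = (2⁻¹ : ℂ) • (v + (-1 : ℂ) ^ e.val •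
      onFirst (tensor (Function.update 1 i (pauli a b))) v) := by
  funext x y
  simp only [pauliProj, onFirst, tensor_update_one_mulVec, Pi.smul_apply, Pi.add_apply,
    smul_eq_mul]
  ring

theorem tensor_update_pauli_mul_self (i : Fin n) (a b : ZMod 2) :
    tensor (Function.update 1 i (pauli a b)) * tensor (Function.update 1 i (pauli a b)) =
      1 := by
  rw [tensor_mul, ← tensor_one]
  congr 1
  funext k
  by_cases hk : k = i
  · subst hk; simp [pauli_mul_self]
  · simp [hk]

theorem normSq_onFirst {A : Matrix (Bits n) (Bits n) ℂ} (hA : Aᴴ * A = 1) (v : TwoReg n) :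
    normSq (onFirst A v) = normSq v := by
  rw [normSq, normSq, Finset.sum_comm, Finset.sum_comm (f := fun x y => ‖v x y‖ ^ 2)]
  exact Finset.sum_congr rfl fun y _ =>
    sum_norm_sq_mulVec_of_conjTranspose_mul_self hA fun x' => v x' y

theorem sum_normSq_pauliProj (i : Fin n) (a b : ZMod 2) (v : TwoReg n) :
    ∑ e, normSq (pauliProj i a b e v) = normSq v := by
  have hA : (tensor (Function.update 1 i (pauli a b)))ᴴ *
      tensor (Function.update 1 i (pauli a b)) = 1 := by
    have : (tensor (Function.update 1 i (pauli a b)))ᴴ =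
        tensor (Function.update 1 i (pauli a b)) := by
      rw [tensor_conjTranspose]
      congr 1
      funext k
      by_cases hk : k = i
      · subst hk; simp [pauli_conjTranspose]
      · simp [hk]
    rw [this, tensor_update_pauli_mul_self]
  have h := normSq_onFirst hA v
  simp_rw [pauliProj_eq]
  rw [sum_zmod_two]
  set w := onFirst (tensor (Function.update 1 i (pauli a b))) v
  have h2 : 2 * (normSq ((2⁻¹ : ℂ) • (v + (-1 : ℂ) ^ (0 : ZMod 2).val • w)) +
      normSq ((2⁻¹ : ℂ) • (v + (-1 : ℂ) ^ (1 : ZMod 2).val • w))) =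
      normSq v + normSq w := by
    simp only [normSq, ← Finset.sum_add_distrib, Finset.mul_sum]
    refine Finset.sum_congr rfl fun x _ => Finset.sum_congr rfl fun y _ => ?_
    -- The two outcomes are (v + w)/2 and (v - w)/2, where w, the Pauli image of v, has the norm of
    -- v.
    have := parallelogram_law_with_norm ℝ (v x y) (w x y)
    simp only [Pi.smul_apply, Pi.add_apply, smul_eq_mul, norm_mul, norm_inv, ZMod.val_zero,
      val_one_zmod_two, pow_zero, pow_one, one_mul, neg_one_mul, ← sub_eq_add_neg,
      RCLike.norm_ofNat]
    nlinarith
  linarith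

/-- Measuring an observable preserves the eigenvectors of the operators that commute with it. -/
theorem onFirst_pauliProj_of_commute {i : Fin n} {a b : ZMod 2}
    {B : Matrix (Bits n) (Bits n) ℂ}
    (hB : B * tensor (Function.update 1 i (pauli a b)) =
      tensor (Function.update 1 i (pauli a b)) * B)
    {v : TwoReg n} {c : ℂ} (hv : onFirst B v = c • v) (e : ZMod 2) :
    onFirst B (pauliProj i a b e v) = c • pauliProj i a b e v := by
  rw [pauliProj_eq, onFirst_smul, onFirst_add, onFirst_smul, onFirst_onFirst, hB,
    ← onFirst_onFirst, hv, onFirst_smul]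
  module

theorem onFirst_pauliProj_self (i : Fin n) (a b e : ZMod 2) (v : TwoReg n) :
    onFirst (tensor (Function.update 1 i (pauli a b))) (pauliProj i a b e v) =
      (-1 : ℂ) ^ e.val • pauliProj i a b e v := by
  rw [pauliProj_eq, onFirst_smul, onFirst_add, onFirst_smul, onFirst_onFirst,
    tensor_update_pauli_mul_self, onFirst_one, smul_comm ((-1 : ℂ) ^ e.val),
    smul_add ((-1 : ℂ) ^ e.val), smul_smul ((-1 : ℂ) ^ e.val), neg_one_pow_val_mul_self, one_smul, add_comm]

/-- The Hermitian Pauli operator of `h`, restricted to the first `k` qubits. -/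
noncomputable def prefixPauli (h : PauliBits n) (k : ℕ) : Matrix (Bits n) (Bits n) ℂ :=
  tensor fun i => if i.val < k then pauli (h i).1 (h i).2 else 1

theorem prefixPauli_zero (h : PauliBits n) : prefixPauli h 0 = 1 := by
  simp [prefixPauli, tensor_one]

theorem prefixPauli_self (h : PauliBits n) :
    prefixPauli h n = tensor fun k => pauli (h k).1 (h k).2 := by
  simp [prefixPauli]

theorem prefixPauli_succ (h : PauliBits n) (i : Fin n) :
    prefixPauli h (i + 1) =
      tensor (Function.update 1 i (pauli (h i).1 (h i).2)) * prefixPauli h i := by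
  rw [prefixPauli, prefixPauli, tensor_mul]
  congr 1
  funext k
  by_cases hk : k = i
  · subst hk; simp
  · have : k.val ≠ i.val := fun h => hk (Fin.ext h)
    have h2 : k.val < i.val + 1 ↔ k.val < i.val := by omega
    simp [hk, h2]

theorem prefixPauli_commute (h : PauliBits n) (m : ℕ) (i : Fin n) :
    prefixPauli h m * tensor (Function.update 1 i (pauli (h i).1 (h i).2)) =
      tensor (Function.update 1 i (pauli (h i).1 (h i).2)) * prefixPauli h m := by
  rw [prefixPauli, tensor_mul, tensor_mul]
  congr 1
  funext k
  by_cases hk : k = i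
  · subst hk; by_cases hm : k.val < m <;> simp [hm]
  · simp [hk]

/-- The new measurement commutes with the prefix operator and so keeps its eigenvalue, while the new
factor takes the measured eigenvalue. Hence the running parity of the outcomes is the sign of the
growing prefix. -/
theorem onFirst_prefixPauli_succ {h : PauliBits n} {i : Fin n} {v : TwoReg n} {e : ZMod 2}
    (hv : onFirst (prefixPauli h i) v = (-1 : ℂ) ^ e.val • v) (e' : ZMod 2) :
    onFirst (prefixPauli h (i + 1)) (pauliProj i (h i).1 (h i).2 e' v) =
      (-1 : ℂ) ^ (e + e').val • pauliProj i (h i).1 (h i).2 e' v := by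
  rw [prefixPauli_succ, ← onFirst_onFirst,
    onFirst_pauliProj_of_commute (prefixPauli_commute h i i) hv, onFirst_smul,
    onFirst_pauliProj_self, smul_smul, neg_one_pow_val_add]

theorem onFirst_product (A : Matrix (Bits n) (Bits n) ℂ) (u w : Bits n → ℂ) :
    onFirst A (fun x y => u x * w y) = fun x y => (A *ᵥ u) x * w y := by
  funext x y
  simp only [onFirst, Matrix.mulVec, dotProduct, Finset.sum_mul, mul_assoc]

variable {ψ : Bits n → ℂ}

/-! ### Basic facts on configurations -/

namespace Config

@[simp] theorem tick_reg (s : Config n) (k : ℕ) : (s.tick k).reg = s.reg := rfl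
@[simp] theorem tick_bit (s : Config n) (k : ℕ) : (s.tick k).bit = s.bit := rfl
@[simp] theorem tick_time (s : Config n) (k : ℕ) : (s.tick k).time = s.time + k := rfl
@[simp] theorem tick_copies (s : Config n) (k : ℕ) : (s.tick k).copies = s.copies := rfl
@[simp] theorem tick_prob (s : Config n) (k : ℕ) : (s.tick k).prob = s.prob := rfl
@[simp] theorem tick_vec (s : Config n) (k : ℕ) : (s.tick k).vec = s.vec := rfl
@[simp] theorem setReg_reg (s : Config n) (r k : ℕ) :
    (s.setReg r k).reg = Function.update s.reg r k := rfl
@[simp] theorem setReg_bit (s : Config n) (r k : ℕ) : (s.setReg r k).bit = s.bit := rfl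
@[simp] theorem setReg_time (s : Config n) (r k : ℕ) : (s.setReg r k).time = s.time := rfl
@[simp] theorem setReg_copies (s : Config n) (r k : ℕ) : (s.setReg r k).copies = s.copies := rfl
@[simp] theorem setReg_vec (s : Config n) (r k : ℕ) : (s.setReg r k).vec = s.vec := rfl
@[simp] theorem setBit_reg (s : Config n) (p : BitRef) (b : ZMod 2) :
    (s.setBit p b).reg = s.reg := rfl
@[simp] theorem setBit_bit (s : Config n) (p : BitRef) (b : ZMod 2) :
    (s.setBit p b).bit = Function.update s.bit (s.addr p) b := rfl
@[simp] theorem setBit_vec (s : Config n) (p : BitRef) (b : ZMod 2) :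
    (s.setBit p b).vec = s.vec := rfl
@[simp] theorem load_reg (s : Config n) (u w : Bits n → ℂ) (k : ℕ) :
    (s.load u w k).reg = s.reg := rfl
@[simp] theorem load_bit (s : Config n) (u w : Bits n → ℂ) (k : ℕ) :
    (s.load u w k).bit = s.bit := rfl
@[simp] theorem load_vec (s : Config n) (u w : Bits n → ℂ) (k : ℕ) :
    (s.load u w k).vec = fun x y => u x * w y := rfl
@[simp] theorem addr_eq (s : Config n) (a r c : ℕ) :
    s.addr ⟨a, r, c⟩ = (a, s.reg r, s.reg c) := rfl
@[simp] theorem getBit_eq (s : Config n) (a r c : ℕ) :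
    s.getBit ⟨a, r, c⟩ = s.bit (a, s.reg r, s.reg c) := rfl

theorem weight_eq (s : Config n) : s.weight = s.prob * normSq s.vec := rfl

end Config

/-! ### Loops -/

/-- The branches after `k` iterations of a loop with body `c` and counter `i`. -/
noncomputable def loopBranches (ψ : Bits n → ℂ) (i : ℕ) (c : Cmd) (s : Config n) :
    ℕ → Multiset (Config n)
  | 0 => {s}
  | k + 1 => (loopBranches ψ i c s k).bind fun s' => exec ψ c ((s'.tick 1).setReg i k)

theorem exec_forLoop (i r : ℕ) (c : Cmd) (s : Config n) :
    exec ψ (.forLoop i r c) s = loopBranches ψ i c (s.tick 1) (s.reg r) := by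
  rw [exec]
  induction s.reg r with
  | zero => rfl
  | succ k ih => rw [List.range_succ, List.foldl_append, ih]; rfl

theorem mem_exec_seq {c d : Cmd} {s t : Config n} :
    t ∈ exec ψ (.seq c d) s ↔ ∃ u ∈ exec ψ c s, t ∈ exec ψ d u := by
  rw [exec, Multiset.mem_bind]

theorem loopBranches_induction {i : ℕ} {c : Cmd} {s : Config n} {N : ℕ}
    (I : ℕ → Config n → Prop) (h0 : I 0 s)
    (hstep : ∀ k < N, ∀ t, I k t → ∀ t' ∈ exec ψ c ((t.tick 1).setReg i k), I (k + 1) t') :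
    ∀ t ∈ loopBranches ψ i c s N, I N t := by
  induction N with
  | zero => intro t ht; rw [loopBranches, Multiset.mem_singleton] at ht; exact ht ▸ h0
  | succ N ih =>
    intro t ht
    rw [loopBranches, Multiset.mem_bind] at ht
    obtain ⟨u, hu, ht⟩ := ht
    exact hstep N (Nat.lt_succ_self N) u
      (ih (fun k hk => hstep k (hk.trans (Nat.lt_succ_self N))) u hu) t ht

/-- The rule for loop invariants on all branches. The step counted for the iteration and the new
value of the counter are applied before the body runs. -/
theorem forLoop_induction {i r : ℕ} {c : Cmd} {s : Config n}
    (I : ℕ → Config n → Prop) (h0 : I 0 (s.tick 1))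
    (hstep : ∀ k < s.reg r, ∀ t, I k t →
      ∀ t' ∈ exec ψ c ((t.tick 1).setReg i k), I (k + 1) t') :
    ∀ t ∈ exec ψ (.forLoop i r c) s, I (s.reg r) t := by
  rw [exec_forLoop]
  exact loopBranches_induction I h0 hstep

/-! ### What a program does not change -/

namespace Cmd

/-- The index registers that a program writes. -/
def regs : Cmd → Finset ℕ
  | seq c d => c.regs ∪ d.regs
  | zero r => {r}
  | copy r _ => {r}
  | inc r => {r}
  | ifLt _ _ c d => c.regs ∪ d.regs
  | forLoop i _ c => insert i c.regs
  | ifBit _ c d => c.regs ∪ d.regs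
  | _ => ∅

/-- The bit arrays that a program writes. -/
def arrays : Cmd → Finset ℕ
  | seq c d => c.arrays ∪ d.arrays
  | ifLt _ _ c d => c.arrays ∪ d.arrays
  | forLoop _ _ c => c.arrays
  | ifBit _ c d => c.arrays ∪ d.arrays
  | setBit p _ => {p.arr}
  | xorBit p _ => {p.arr}
  | bell _ p q => {p.arr, q.arr}
  | meas _ _ _ p => {p.arr}
  | _ => ∅

/-- The program has no quantum operations other than Bell measurements. -/
def BellOnly : Cmd → Prop
  | seq c d => c.BellOnly ∧ d.BellOnly
  | ifLt _ _ c d => c.BellOnly ∧ d.BellOnly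
  | forLoop _ _ c => c.BellOnly
  | ifBit _ c d => c.BellOnly ∧ d.BellOnly
  | loadOne => False
  | loadTwo => False
  | meas _ _ _ _ => False
  | _ => True

/-- The program does not load the quantum registers. -/
def NoLoad : Cmd → Prop
  | seq c d => c.NoLoad ∧ d.NoLoad
  | ifLt _ _ c d => c.NoLoad ∧ d.NoLoad
  | forLoop _ _ c => c.NoLoad
  | ifBit _ c d => c.NoLoad ∧ d.NoLoad
  | loadOne => False
  | loadTwo => False
  | _ => True

end Cmd

/-- A frame rule. For a concrete program the set of written registers is computed from its text, so
the side condition can usually be discharged by `decide`. -/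
theorem reg_eq_of_mem_exec {c : Cmd} {s t : Config n} (ht : t ∈ exec ψ c s) {r : ℕ}
    (hr : r ∉ c.regs) : t.reg r = s.reg r := by
  induction c generalizing s t with
  | seq c d ihc ihd =>
    obtain ⟨u, hu, ht⟩ := mem_exec_seq.mp ht
    rw [Cmd.regs, Finset.notMem_union] at hr
    rw [ihd ht hr.2, ihc hu hr.1]
  | forLoop i q c ih =>
    rw [Cmd.regs, Finset.mem_insert, not_or] at hr
    refine forLoop_induction (fun _ t => t.reg r = s.reg r) rfl ?_ t ht
    intro k _ u hu t' ht'
    rw [ih ht' hr.2, Config.setReg_reg, Function.update_of_ne hr.1]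
    exact hu
  | ifLt a b c d ihc ihd =>
    rw [Cmd.regs, Finset.notMem_union] at hr
    rw [exec] at ht
    split_ifs at ht
    · exact ihc (s := s.tick 1) ht hr.1
    · exact ihd (s := s.tick 1) ht hr.2
  | ifBit p c d ihc ihd =>
    rw [Cmd.regs, Finset.notMem_union] at hr
    rw [exec] at ht
    split_ifs at ht
    · exact ihc (s := s.tick 1) ht hr.1
    · exact ihd (s := s.tick 1) ht hr.2
  | bell i p q =>
    rw [exec] at ht
    split_ifs at ht
    · obtain ⟨e, _, rfl⟩ := Multiset.mem_map.mp ht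
      rfl
    · rw [Multiset.mem_singleton.mp ht]; rfl
  | meas a b i p =>
    rw [exec] at ht
    split_ifs at ht
    · obtain ⟨e, _, rfl⟩ := Multiset.mem_map.mp ht
      rfl
    · rw [Multiset.mem_singleton.mp ht]; rfl
  | _ =>
    rw [exec] at ht
    rw [Multiset.mem_singleton.mp ht]
    simp_all [Cmd.regs]

theorem bit_eq_of_mem_exec {c : Cmd} {s t : Config n} (ht : t ∈ exec ψ c s) {a : ℕ}
    (ha : a ∉ c.arrays) (i j : ℕ) : t.bit (a, i, j) = s.bit (a, i, j) := by
  induction c generalizing s t with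
  | seq c d ihc ihd =>
    obtain ⟨u, hu, ht⟩ := mem_exec_seq.mp ht
    rw [Cmd.arrays, Finset.notMem_union] at ha
    rw [ihd ht ha.2, ihc hu ha.1]
  | forLoop l q c ih =>
    refine forLoop_induction (fun _ t => t.bit (a, i, j) = s.bit (a, i, j)) rfl ?_ t ht
    intro k _ u hu t' ht'
    rw [ih ht' ha, ← hu]
    rfl
  | ifLt l m c d ihc ihd =>
    rw [Cmd.arrays, Finset.notMem_union] at ha
    rw [exec] at ht
    split_ifs at ht
    · exact ihc (s := s.tick 1) ht ha.1
    · exact ihd (s := s.tick 1) ht ha.2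
  | ifBit p c d ihc ihd =>
    rw [Cmd.arrays, Finset.notMem_union] at ha
    rw [exec] at ht
    split_ifs at ht
    · exact ihc (s := s.tick 1) ht ha.1
    · exact ihd (s := s.tick 1) ht ha.2
  | bell l p q =>
    rw [exec] at ht
    split_ifs at ht
    · obtain ⟨e, _, rfl⟩ := Multiset.mem_map.mp ht
      simp_all [Cmd.arrays, Config.addr]
    · rw [Multiset.mem_singleton.mp ht]; rfl
  | meas b b' l p =>
    rw [exec] at ht
    split_ifs at ht
    · obtain ⟨e, _, rfl⟩ := Multiset.mem_map.mp ht
      simp_all [Cmd.arrays, Config.addr]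
    · rw [Multiset.mem_singleton.mp ht]; rfl
  | _ =>
    rw [exec] at ht
    rw [Multiset.mem_singleton.mp ht]
    simp_all [Cmd.arrays, Config.addr]

theorem prob_eq_of_mem_exec {c : Cmd} {s t : Config n} (ht : t ∈ exec ψ c s)
    (hc : c.NoLoad) : t.prob = s.prob := by
  induction c generalizing s t with
  | seq c d ihc ihd =>
    obtain ⟨u, hu, ht⟩ := mem_exec_seq.mp ht
    rw [ihd ht hc.2, ihc hu hc.1]
  | forLoop l q c ih =>
    refine forLoop_induction (fun _ t => t.prob = s.prob) rfl ?_ t ht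
    intro k _ u hu t' ht'
    rw [ih ht' hc, ← hu]
    rfl
  | ifLt l m c d ihc ihd =>
    rw [exec] at ht
    split_ifs at ht
    · exact ihc (s := s.tick 1) ht hc.1
    · exact ihd (s := s.tick 1) ht hc.2
  | ifBit p c d ihc ihd =>
    rw [exec] at ht
    split_ifs at ht
    · exact ihc (s := s.tick 1) ht hc.1
    · exact ihd (s := s.tick 1) ht hc.2
  | loadOne => exact hc.elim
  | loadTwo => exact hc.elim
  | bell l p q =>
    rw [exec] at ht
    split_ifs at ht
    · obtain ⟨e, _, rfl⟩ := Multiset.mem_map.mp ht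
      rfl
    · rw [Multiset.mem_singleton.mp ht]; rfl
  | meas b b' l p =>
    rw [exec] at ht
    split_ifs at ht
    · obtain ⟨e, _, rfl⟩ := Multiset.mem_map.mp ht
      rfl
    · rw [Multiset.mem_singleton.mp ht]; rfl
  | _ =>
    rw [exec] at ht
    rw [Multiset.mem_singleton.mp ht]
    rfl

/-! ### Conservation of probability -/

theorem sum_map_loopBranches {i : ℕ} {c : Cmd} {F : Config n → ℝ}
    (hc : ∀ s, ((exec ψ c s).map F).sum = F s)
    (hF : ∀ s k, F ((Config.tick s 1).setReg i k) = F s) (s : Config n) (N : ℕ) :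
    ((loopBranches ψ i c s N).map F).sum = F s := by
  induction N with
  | zero => simp [loopBranches]
  | succ N ih =>
    rw [loopBranches, Multiset.map_bind, Multiset.sum_bind]
    simp_rw [hc, hF]
    exact ih

/-- A function of the quantum registers that measurements conserve is conserved. -/
theorem sum_map_exec {f : ℝ → TwoReg n → ℝ}
    (hbell : ∀ p i v, ∑ q : ZMod 2 × ZMod 2, f p (bellProj i q.1 q.2 v) = f p v) {c : Cmd}
    -- The conditions on Pauli measurements and on loads are asked only of programs that are not
    -- `BellOnly`. One induction then covers both the total probability of any program and the
    -- probability mass on a set of Bell outcomes.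
    (hq : ¬ c.BellOnly → (∀ p i a b v, ∑ e, f p (pauliProj i a b e v) = f p v) ∧
      (∀ p v, f (p * normSq v) (fun x y => ψ x * if y = 0 then 1 else 0) = f p v) ∧
      ∀ p v, f (p * normSq v) (fun x y => ψ x * ψ y) = f p v) (s : Config n) :
    ((exec ψ c s).map fun t => f t.prob t.vec).sum = f s.prob s.vec := by
  induction c generalizing s with
  | seq c d ihc ihd =>
    rw [exec, Multiset.map_bind, Multiset.sum_bind]
    simp_rw [ihd fun h => hq fun h' => h h'.2]
    exact ihc (fun h => hq fun h' => h h'.1) s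
  | forLoop i r c ih =>
    rw [exec_forLoop]
    exact sum_map_loopBranches (F := fun t => f t.prob t.vec) (ih hq) (fun _ _ => rfl) _ _
  | ifLt a b c d ihc ihd =>
    rw [exec]
    split_ifs
    · exact ihc (fun h => hq fun h' => h h'.1) _
    · exact ihd (fun h => hq fun h' => h h'.2) _
  | ifBit p c d ihc ihd =>
    rw [exec]
    split_ifs
    · exact ihc (fun h => hq fun h' => h h'.1) _
    · exact ihd (fun h => hq fun h' => h h'.2) _
  | bell i p q =>
    rw [exec]
    split_ifs
    · rw [Multiset.map_map]; exact hbell _ _ _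
    · simp
  | meas a b i p =>
    rw [exec]
    split_ifs
    · rw [Multiset.map_map]; exact (hq id).1 _ _ _ _ _
    · simp
  | loadOne =>
    rw [exec, Multiset.map_singleton, Multiset.sum_singleton]
    exact (hq id).2.1 _ _
  | loadTwo =>
    rw [exec, Multiset.map_singleton, Multiset.sum_singleton]
    exact (hq id).2.2 _ _
  | _ =>
    rw [exec, Multiset.map_singleton, Multiset.sum_singleton]
    rfl

theorem normSq_product {ψ : Bits n → ℂ} (hψ : ∑ x, ‖ψ x‖ ^ 2 = 1) (φ : Bits n → ℂ) :
    normSq (fun x y => ψ x * φ y) = ∑ x, ‖φ x‖ ^ 2 := by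
  simp [normSq, mul_pow, ← Finset.mul_sum, ← Finset.sum_mul, hψ]

theorem sum_weight_exec (hψ : ∑ x, ‖ψ x‖ ^ 2 = 1) (c : Cmd) (s : Config n) :
    ((exec ψ c s).map Config.weight).sum = s.weight := by
  have hbell : ∀ (p : ℝ) (i : Fin n) (v : TwoReg n),
      ∑ q : ZMod 2 × ZMod 2, p * normSq (bellProj i q.1 q.2 v) = p * normSq v := by
    intro p i v
    rw [← Finset.mul_sum, sum_normSq_bellProj]
  have hmeas : ∀ (p : ℝ) (i : Fin n) (a b : ZMod 2) (v : TwoReg n),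
      ∑ e, p * normSq (pauliProj i a b e v) = p * normSq v := by
    intro p i a b v
    rw [← Finset.mul_sum, sum_normSq_pauliProj]
  have hone : ∀ (p : ℝ) (v : TwoReg n), p * normSq v *
      normSq (fun x y : Bits n => ψ x * if y = 0 then 1 else 0) = p * normSq v := by
    intro p v
    rw [normSq_product hψ, Finset.sum_eq_single 0]
    · simp
    · intro y _ hy
      simp [hy]
    · simp
  have htwo : ∀ (p : ℝ) (v : TwoReg n), p * normSq v *
      normSq (fun x y : Bits n => ψ x * ψ y) = p * normSq v := by
    intro p v
    rw [normSq_product hψ, hψ, mul_one]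
  exact sum_map_exec (f := fun p v => p * normSq v) hbell (fun _ => ⟨hmeas, hone, htwo⟩) s

theorem normSq_nonneg (v : TwoReg n) : 0 ≤ normSq v :=
  Finset.sum_nonneg fun _ _ => Finset.sum_nonneg fun _ _ => by positivity

theorem normSq_bellProj_le (i : Fin n) (a b : ZMod 2) (v : TwoReg n) :
    normSq (bellProj i a b v) ≤ normSq v := by
  have h := Finset.single_le_sum
    (f := fun q : ZMod 2 × ZMod 2 => normSq (bellProj i q.1 q.2 v))
    (fun _ _ => normSq_nonneg _) (Finset.mem_univ (a, b))
  rw [sum_normSq_bellProj i v] at h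
  exact h

theorem normSq_pauliProj_le (i : Fin n) (a b e : ZMod 2) (v : TwoReg n) :
    normSq (pauliProj i a b e v) ≤ normSq v := by
  have h := Finset.single_le_sum (f := fun e => normSq (pauliProj i a b e v))
    (fun _ _ => normSq_nonneg _) (Finset.mem_univ e)
  rw [sum_normSq_pauliProj i a b v] at h
  exact h

theorem exists_mul_eq_of_le {x y : ℝ} (hx : 0 ≤ x) (h : x ≤ y) : ∃ t, 0 ≤ t ∧ x = t * y := by
  rcases (hx.trans h).eq_or_lt with hy | hy
  · exact ⟨0, le_rfl, by linarith⟩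
  · exact ⟨x / y, by positivity, by field_simp⟩

theorem weight_eq_of_card_eq_one (hψ : ∑ x, ‖ψ x‖ ^ 2 = 1) {c : Cmd} {s t : Config n}
    (hc : (exec ψ c s).card = 1) (ht : t ∈ exec ψ c s) : t.weight = s.weight := by
  obtain ⟨u, hu⟩ := Multiset.card_eq_one.mp hc
  rw [← sum_weight_exec hψ c s, hu, Multiset.map_singleton, Multiset.sum_singleton]
  rw [hu, Multiset.mem_singleton] at ht
  rw [ht]

/-- The weight of a branch is multiplied by a conditional probability. -/
theorem exists_weight_eq_mul (hψ : ∑ x, ‖ψ x‖ ^ 2 = 1) {c : Cmd} {s t : Config n}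
    (ht : t ∈ exec ψ c s) : ∃ p : ℝ, 0 ≤ p ∧ t.weight = p * s.weight := by
  induction c generalizing s t with
  | seq c d ihc ihd =>
    obtain ⟨u, hu, ht⟩ := mem_exec_seq.mp ht
    obtain ⟨p, hp, h⟩ := ihc hu
    obtain ⟨q, hq, h'⟩ := ihd ht
    exact ⟨q * p, by positivity, by rw [h', h, mul_assoc]⟩
  | forLoop l q c ih =>
    refine forLoop_induction (fun _ t => ∃ p : ℝ, 0 ≤ p ∧ t.weight = p * s.weight)
      ⟨1, by norm_num, (one_mul _).symm⟩ ?_ t ht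
    rintro k _ u ⟨p, hp, h⟩ t' ht'
    obtain ⟨q, hq, h'⟩ := ih ht'
    exact ⟨q * p, by positivity, by rw [h', mul_assoc, ← h]; rfl⟩
  | ifLt l m c d ihc ihd =>
    rw [exec] at ht
    split_ifs at ht
    · exact ihc (s := s.tick 1) ht
    · exact ihd (s := s.tick 1) ht
  | ifBit p c d ihc ihd =>
    rw [exec] at ht
    split_ifs at ht
    · exact ihc (s := s.tick 1) ht
    · exact ihd (s := s.tick 1) ht
  | bell l p q =>
    rw [exec] at ht
    split_ifs at ht with hl
    · obtain ⟨e, _, rfl⟩ := Multiset.mem_map.mp ht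
      obtain ⟨p, hp, h⟩ := exists_mul_eq_of_le (normSq_nonneg _)
        (normSq_bellProj_le ⟨s.reg l, hl⟩ e.1 e.2 s.vec)
      exact ⟨p, hp, by
        rw [Config.weight_eq, Config.weight_eq, mul_left_comm, ← h]; rfl⟩
    · exact ⟨1, by norm_num, by rw [Multiset.mem_singleton.mp ht, one_mul]; rfl⟩
  | meas a b l p =>
    rw [exec] at ht
    split_ifs at ht with hl
    · obtain ⟨e, _, rfl⟩ := Multiset.mem_map.mp ht
      obtain ⟨p, hp, h⟩ := exists_mul_eq_of_le (normSq_nonneg _)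
        (normSq_pauliProj_le ⟨s.reg l, hl⟩ a b e s.vec)
      exact ⟨p, hp, by
        rw [Config.weight_eq, Config.weight_eq, mul_left_comm, ← h]; rfl⟩
    · exact ⟨1, by norm_num, by rw [Multiset.mem_singleton.mp ht, one_mul]; rfl⟩
  | _ =>
    exact ⟨1, by norm_num, by
      rw [one_mul, weight_eq_of_card_eq_one hψ (by rw [exec, Multiset.card_singleton]) ht]⟩

/-! ### Bounds on time and copies -/

namespace Cmd

/-- A bound on the number of steps, if `β` bounds the index registers. -/
def timeBound (n : ℕ) (β : ℕ → ℕ) : Cmd → ℕ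
  | seq c d => c.timeBound n β + d.timeBound n β
  | ifLt _ _ c d => 1 + c.timeBound n β + d.timeBound n β
  | forLoop _ r c => 1 + β r * (1 + c.timeBound n β)
  | ifBit _ c d => 1 + c.timeBound n β + d.timeBound n β
  | loadOne => 2 * n + 1
  | loadTwo => 2 * n + 1
  | _ => 1

/-- A bound on the number of copies of the state, if `β` bounds the index registers. -/
def copyBound (β : ℕ → ℕ) : Cmd → ℕ
  | seq c d => c.copyBound β + d.copyBound β
  | ifLt _ _ c d => c.copyBound β + d.copyBound β
  | forLoop _ r c => β r * c.copyBound β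
  | ifBit _ c d => c.copyBound β + d.copyBound β
  | loadOne => 1
  | loadTwo => 2
  | _ => 0

/-- The index registers that bound the loops of a program are in `S`. -/
def LoopsOn (S : Finset ℕ) : Cmd → Prop
  | seq c d => c.LoopsOn S ∧ d.LoopsOn S
  | ifLt _ _ c d => c.LoopsOn S ∧ d.LoopsOn S
  | forLoop _ r c => r ∈ S ∧ c.LoopsOn S
  | ifBit _ c d => c.LoopsOn S ∧ d.LoopsOn S
  | _ => True

end Cmd

/-- The registers that bound the loops are never written by the program, so their initial bounds
hold at every loop entry and the cost can be computed from the program text. The two branches of a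
test are simply added. -/
theorem resources_le {S : Finset ℕ} {β : ℕ → ℕ} {c : Cmd} (hl : c.LoopsOn S)
    (hS : ∀ r ∈ S, r ∉ c.regs) {s t : Config n} (hβ : ∀ r ∈ S, s.reg r ≤ β r)
    (ht : t ∈ exec ψ c s) :
    t.time ≤ s.time + c.timeBound n β ∧ t.copies ≤ s.copies + c.copyBound β := by
  induction c generalizing s t with
  | seq c d ihc ihd =>
    obtain ⟨u, hu, ht⟩ := mem_exec_seq.mp ht
    simp only [Cmd.regs, Finset.notMem_union] at hS
    have h1 := ihc hl.1 (fun r hr => (hS r hr).1) hβ hu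
    have h2 := ihd hl.2 (fun r hr => (hS r hr).2)
      (fun r hr => (reg_eq_of_mem_exec hu (hS r hr).1).trans_le (hβ r hr)) ht
    simp only [Cmd.timeBound, Cmd.copyBound]
    omega
  | forLoop i q c ih =>
    simp only [Cmd.regs, Finset.mem_insert, not_or] at hS
    have h := forLoop_induction (fun k u => (∀ r ∈ S, u.reg r ≤ β r) ∧
        u.time ≤ s.time + (1 + k * (1 + c.timeBound n β)) ∧
        u.copies ≤ s.copies + k * c.copyBound β) ⟨hβ, by simp, by simp⟩ ?_ t ht
    · have hq := hβ q hl.1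
      have h1 := Nat.mul_le_mul_right (1 + c.timeBound n β) hq
      have h2 := Nat.mul_le_mul_right (c.copyBound β) hq
      simp only [Cmd.timeBound, Cmd.copyBound]
      omega
    · rintro k _ u ⟨hr, hu1, hu2⟩ t' ht'
      have hr' : ∀ r ∈ S, ((u.tick 1).setReg i k).reg r ≤ β r := fun r h => by
        rw [Config.setReg_reg, Function.update_of_ne (hS r h).1]
        exact hr r h
      have h3 := ih hl.2 (fun r hr => (hS r hr).2) hr' ht'
      simp only [Config.setReg_time, Config.tick_time, Config.setReg_copies,
        Config.tick_copies] at h3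
      refine ⟨fun r h => ?_, ?_, ?_⟩
      · rw [reg_eq_of_mem_exec ht' (hS r h).2]
        exact hr' r h
      · rw [Nat.succ_mul]
        omega
      · rw [Nat.succ_mul]
        omega
  | ifLt a b c d ihc ihd =>
    simp only [Cmd.regs, Finset.notMem_union] at hS
    simp only [Cmd.timeBound, Cmd.copyBound]
    rw [exec] at ht
    split_ifs at ht
    · have h1 := ihc (s := s.tick 1) hl.1 (fun r hr => (hS r hr).1) hβ ht
      simp only [Config.tick_time, Config.tick_copies] at h1
      omega
    · have h1 := ihd (s := s.tick 1) hl.2 (fun r hr => (hS r hr).2) hβ ht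
      simp only [Config.tick_time, Config.tick_copies] at h1
      omega
  | ifBit p c d ihc ihd =>
    simp only [Cmd.regs, Finset.notMem_union] at hS
    simp only [Cmd.timeBound, Cmd.copyBound]
    rw [exec] at ht
    split_ifs at ht
    · have h1 := ihc (s := s.tick 1) hl.1 (fun r hr => (hS r hr).1) hβ ht
      simp only [Config.tick_time, Config.tick_copies] at h1
      omega
    · have h1 := ihd (s := s.tick 1) hl.2 (fun r hr => (hS r hr).2) hβ ht
      simp only [Config.tick_time, Config.tick_copies] at h1
      omega
  | bell i p q =>
    rw [exec] at ht
    split_ifs at ht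
    · obtain ⟨e, _, rfl⟩ := Multiset.mem_map.mp ht
      exact ⟨le_rfl, le_rfl⟩
    · rw [Multiset.mem_singleton.mp ht]; exact ⟨le_rfl, le_rfl⟩
  | meas a b i p =>
    rw [exec] at ht
    split_ifs at ht
    · obtain ⟨e, _, rfl⟩ := Multiset.mem_map.mp ht
      exact ⟨le_rfl, le_rfl⟩
    · rw [Multiset.mem_singleton.mp ht]; exact ⟨le_rfl, le_rfl⟩
  | _ =>
    rw [exec] at ht
    rw [Multiset.mem_singleton.mp ht]
    exact ⟨le_rfl, le_rfl⟩

/-! ### Branches of positive probability -/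

/-- The run of `c` from `s` has a branch `t` of positive weight. -/
def Runs (ψ : Bits n → ℂ) (c : Cmd) (s t : Config n) : Prop :=
  t ∈ exec ψ c s ∧ 0 < t.weight

theorem weight_pos_of_mem_exec (hψ : ∑ x, ‖ψ x‖ ^ 2 = 1) {c : Cmd} {s t : Config n}
    (ht : t ∈ exec ψ c s) (hw : 0 < t.weight) : 0 < s.weight := by
  obtain ⟨p, hp, h⟩ := exists_weight_eq_mul hψ ht
  rw [h] at hw
  exact pos_of_mul_pos_right hw hp

theorem Runs.seq (hψ : ∑ x, ‖ψ x‖ ^ 2 = 1) {c d : Cmd} {s t : Config n}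
    (h : Runs ψ (.seq c d) s t) : ∃ u, Runs ψ c s u ∧ Runs ψ d u t := by
  obtain ⟨u, hu, ht⟩ := mem_exec_seq.mp h.1
  exact ⟨u, ⟨hu, weight_pos_of_mem_exec hψ ht h.2⟩, ht, h.2⟩

/-- The invariant need only survive outcomes of positive probability: weights along a branch are
products of conditional probabilities, so every ancestor of a branch of positive weight has positive
weight. -/
theorem Runs.forLoop (hψ : ∑ x, ‖ψ x‖ ^ 2 = 1) {i r : ℕ} {c : Cmd} {s t : Config n}
    (h : Runs ψ (.forLoop i r c) s t) (I : ℕ → Config n → Prop) (h0 : I 0 (s.tick 1))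
    (hstep : ∀ k < s.reg r, ∀ u, I k u → ∀ u', Runs ψ c ((u.tick 1).setReg i k) u' →
      I (k + 1) u') : I (s.reg r) t := by
  refine forLoop_induction (fun k u => 0 < u.weight → I k u) (fun _ => h0) ?_ t h.1 h.2
  intro k hk u hu u' hu' hw
  exact hstep k hk u (hu (weight_pos_of_mem_exec (s := (u.tick 1).setReg i k) hψ hu' hw)) u'
    ⟨hu', hw⟩

/-! ### Expectations -/

/-- The sum of `u` over the branches of a run, weighted by their probabilities. -/
noncomputable def expect (ψ : Bits n → ℂ) (c : Cmd) (u : Config n → ℝ) (s : Config n) : ℝ :=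
  ((exec ψ c s).map fun t => t.weight * u t).sum

/-- Branches of weight zero contribute nothing to either side, so the comparison is needed only on
possible branches. -/
theorem sum_map_le_expect (hψ : ∑ x, ‖ψ x‖ ^ 2 = 1) {c : Cmd} {s : Config n}
    (hs : 0 ≤ s.weight) {g u : Config n → ℝ} (h0 : ∀ t, t.weight = 0 → g t = 0)
    (h : ∀ t, Runs ψ c s t → g t ≤ t.weight * u t) :
    ((exec ψ c s).map g).sum ≤ expect ψ c u s := by
  refine Multiset.sum_map_le_sum_map _ _ fun t ht => ?_
  obtain ⟨p, hp, hw⟩ := exists_weight_eq_mul hψ ht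
  have hw0 : 0 ≤ t.weight := by rw [hw]; positivity
  rcases hw0.eq_or_lt with h1 | h1
  · rw [h0 t h1.symm, ← h1, zero_mul]
  · exact h t ⟨ht, h1⟩

theorem expect_const (hψ : ∑ x, ‖ψ x‖ ^ 2 = 1) (c : Cmd) (a : ℝ) (s : Config n) :
    expect ψ c (fun _ => a) s = s.weight * a := by
  rw [expect, Multiset.sum_map_mul_right, sum_weight_exec hψ]

theorem expect_mono (hψ : ∑ x, ‖ψ x‖ ^ 2 = 1) {c : Cmd} {s : Config n} (hs : 0 ≤ s.weight)
    {u v : Config n → ℝ} (h : ∀ t, Runs ψ c s t → u t ≤ v t) :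
    expect ψ c u s ≤ expect ψ c v s :=
  sum_map_le_expect hψ hs (fun t ht => by rw [ht, zero_mul]) fun t ht =>
    mul_le_mul_of_nonneg_left (h t ht) ht.2.le

theorem expect_le_const (hψ : ∑ x, ‖ψ x‖ ^ 2 = 1) {c : Cmd} {s : Config n}
    (hs : 0 ≤ s.weight) {u : Config n → ℝ} {a : ℝ} (h : ∀ t, Runs ψ c s t → u t ≤ a) :
    expect ψ c u s ≤ s.weight * a :=
  (expect_mono hψ hs h).trans_eq (expect_const hψ c a s)

theorem expect_eq_zero (hψ : ∑ x, ‖ψ x‖ ^ 2 = 1) {c : Cmd} {s : Config n}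
    (hs : s.weight = 0) (u : Config n → ℝ) : expect ψ c u s = 0 := by
  refine Multiset.sum_eq_zero ?_
  intro x hx
  obtain ⟨t, ht, rfl⟩ := Multiset.mem_map.mp hx
  obtain ⟨p, _, hw⟩ := exists_weight_eq_mul hψ ht
  rw [hw, hs, mul_zero, zero_mul]

theorem expect_seq (c d : Cmd) (u : Config n → ℝ) (s : Config n) :
    expect ψ (.seq c d) u s = ((exec ψ c s).map (expect ψ d u)).sum := by
  rw [expect, exec, Multiset.map_bind, Multiset.sum_bind]
  rfl

theorem expect_seq_le (hψ : ∑ x, ‖ψ x‖ ^ 2 = 1) {c d : Cmd} {u v : Config n → ℝ}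
    {s : Config n} (hs : 0 ≤ s.weight)
    (h : ∀ t, Runs ψ c s t → expect ψ d u t ≤ t.weight * v t) :
    expect ψ (.seq c d) u s ≤ expect ψ c v s := by
  rw [expect_seq]
  exact sum_map_le_expect hψ hs (fun t ht => expect_eq_zero hψ ht u) h

/-- A supermartingale argument: `u k` is a potential for the state after `k` iterations, and one
iteration does not raise its expectation where the invariant `I` holds. -/
theorem expect_forLoop_le (hψ : ∑ x, ‖ψ x‖ ^ 2 = 1) {i r : ℕ} {c : Cmd} {s : Config n}
    (hs : 0 ≤ s.weight) (I : ℕ → Config n → Prop) (u : ℕ → Config n → ℝ)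
    (h0 : I 0 (s.tick 1))
    (hI : ∀ k < s.reg r, ∀ t, I k t → ∀ t', Runs ψ c ((t.tick 1).setReg i k) t' →
      I (k + 1) t')
    (hu : ∀ k < s.reg r, ∀ t, 0 < t.weight → I k t →
      expect ψ c (u (k + 1)) ((t.tick 1).setReg i k) ≤ t.weight * u k t) :
    expect ψ (.forLoop i r c) (u (s.reg r)) s ≤ s.weight * u 0 (s.tick 1) := by
  rw [expect, exec_forLoop]
  generalize s.reg r = N at hI hu ⊢
  induction N with
  | zero => simp [loopBranches]; rfl
  | succ N ih =>
    refine le_trans ?_ (ih (fun k hk => hI k (hk.trans N.lt_succ_self))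
      fun k hk => hu k (hk.trans N.lt_succ_self))
    rw [loopBranches, Multiset.map_bind, Multiset.sum_bind]
    refine Multiset.sum_map_le_sum_map _ _ fun t ht => ?_
    have hinv := loopBranches_induction
      (fun k t => 0 ≤ t.weight ∧ (0 < t.weight → I k t)) (s := s.tick 1) (N := N)
      ⟨hs, fun _ => h0⟩ (by
        rintro k hk t ⟨h1, h2⟩ t' ht'
        obtain ⟨p, hp, hw⟩ := exists_weight_eq_mul hψ ht'
        refine ⟨by rw [hw]; exact mul_nonneg hp h1, fun h3 => ?_⟩
        exact hI k (hk.trans N.lt_succ_self) t (h2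
          (weight_pos_of_mem_exec (s := (t.tick 1).setReg i k) hψ ht' h3)) t'
          ⟨ht', h3⟩) t ht
    rcases hinv.1.eq_or_lt with h1 | h1
    · rw [← h1, zero_mul]
      exact (expect_eq_zero hψ (s := (t.tick 1).setReg i N) h1.symm (u (N + 1))).le
    · exact hu N N.lt_succ_self t h1 (hinv.2 h1)

/-! ### Incremental Gaussian elimination -/

/-- The bit of `h` in column `c`, where every qubit has two columns. -/
def coord (h : PauliBits n) (c : ℕ) : ZMod 2 :=
  if hc : c / 2 < n then if c % 2 = 0 then (h ⟨c / 2, hc⟩).1 else (h ⟨c / 2, hc⟩).2 else 0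

theorem coord_add (h g : PauliBits n) (c : ℕ) : coord (h + g) c = coord h c + coord g c := by
  unfold coord
  split_ifs <;> simp

theorem eq_zero_of_coord {h : PauliBits n} (hc : ∀ c < 2 * n, coord h c = 0) : h = 0 := by
  funext k
  have h1 := hc (2 * k) (by omega)
  have h2 := hc (2 * k + 1) (by omega)
  have e1 : 2 * k.val / 2 = k := by omega
  have e2 : (2 * k.val + 1) / 2 = k := by omega
  have e3 : (2 * k.val + 1) % 2 = 1 := by omega
  simp [coord, e1] at h1
  simp [coord, e2, e3] at h2
  exact Prod.ext h1 h2

theorem add_self_pauliBits (h : PauliBits n) : h + h = 0 :=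
  funext fun _ => Prod.ext (CharTwo.add_self_eq_zero _) (CharTwo.add_self_eq_zero _)

/-- The state of the elimination: the first `d` vectors `out` are a basis of the span of the
vectors seen so far, and `B p`, if its bit in column `p` is `1`, is a vector of this span with
leading bit in column `p`. -/
structure Echelon (T : Submodule (ZMod 2) (PauliBits n)) (B out : ℕ → PauliBits n) (d : ℕ) :
    Prop where
  indep : LinearIndepOn (ZMod 2) out (Set.Iio d)
  mem : ∀ i < d, out i ∈ T
  row_mem : ∀ p < 2 * n, coord (B p) p = 1 →
    B p ∈ Submodule.span (ZMod 2) (out '' Set.Iio d)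
  lead : ∀ p < 2 * n, coord (B p) p = 1 → ∀ c < p, coord (B p) c = 0
  pivot : ∀ w ∈ Submodule.span (ZMod 2) (out '' Set.Iio d), ∀ p < 2 * n,
    (∀ c < p, coord w c = 0) → coord (B p) p = 0 → coord w p = 0

theorem echelon_zero (T : Submodule (ZMod 2) (PauliBits n)) (B out : ℕ → PauliBits n)
    (hB : ∀ p, B p = 0) : Echelon T B out 0 where
  indep := by simp
  mem := by simp
  row_mem p _ h := by simp [hB, coord] at h
  lead p _ h := by simp [hB, coord] at h
  pivot w hw p _ _ _ := by
    have : w = 0 := by simpa using hw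
    simp [this, coord]

namespace Echelon

variable {T : Submodule (ZMod 2) (PauliBits n)} {B out : ℕ → PauliBits n} {d : ℕ}

theorem span_le (h : Echelon T B out d) :
    Submodule.span (ZMod 2) (out '' Set.Iio d) ≤ T := by
  rw [Submodule.span_le]
  rintro _ ⟨i, hi, rfl⟩
  exact h.mem i hi

/-- By `pivot`, no vector of the span has its leading bit in a column without a pivot, so `v` is
independent of the earlier vectors. -/
theorem insert (h : Echelon T B out d) {v : PauliBits n} (hv : v ∈ T) {p : ℕ}
    (hp : p < 2 * n) (hlead : ∀ c < p, coord v c = 0) (hvp : coord v p = 1)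
    (hBp : coord (B p) p = 0) :
    Echelon T (Function.update B p v) (Function.update out d v) (d + 1) := by
  have hnot : v ∉ Submodule.span (ZMod 2) (out '' Set.Iio d) := fun hmem => by
    have := h.pivot v hmem p hp hlead hBp
    rw [hvp] at this
    exact one_ne_zero this
  have heq : Set.EqOn out (Function.update out d v) (Set.Iio d) := fun i hi =>
    (Function.update_of_ne (ne_of_lt hi) _ _).symm
  have hIio : Set.Iio (d + 1) = Insert.insert d (Set.Iio d) := by
    ext i; simp only [Set.mem_Iio, Set.mem_insert_iff]; omega
  have himg : Function.update out d v '' Set.Iio (d + 1) =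
      Insert.insert v (out '' Set.Iio d) := by
    rw [hIio, Set.image_insert_eq, Function.update_self, heq.image_eq]
  refine ⟨?_, ?_, ?_, ?_, ?_⟩
  · rw [hIio]
    refine (h.indep.congr heq).insert ?_
    rwa [Function.update_self, ← heq.image_eq]
  · intro i hi
    by_cases hid : i = d
    · rw [hid, Function.update_self]; exact hv
    · rw [Function.update_of_ne hid]; exact h.mem i (by omega)
  · intro q hq hq1
    rw [himg]
    by_cases hqp : q = p
    · rw [hqp, Function.update_self]
      exact Submodule.subset_span (Set.mem_insert _ _)
    · rw [Function.update_of_ne hqp] at hq1 ⊢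
      exact Submodule.span_mono (Set.subset_insert _ _) (h.row_mem q hq hq1)
  · intro q hq hq1
    by_cases hqp : q = p
    · rw [hqp, Function.update_self]; exact hlead
    · rw [Function.update_of_ne hqp] at hq1 ⊢
      exact h.lead q hq hq1
  · intro w hw q hq hwq hq0
    rw [himg, Submodule.mem_span_insert] at hw
    obtain ⟨a, z, hz, rfl⟩ := hw
    by_cases hqp : q = p
    · rw [hqp, Function.update_self, hvp] at hq0
      exact absurd hq0 one_ne_zero
    rw [Function.update_of_ne hqp] at hq0
    rcases zmod_two_eq_zero_or_one a with rfl | rfl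
    · rw [zero_smul, zero_add] at hwq ⊢
      exact h.pivot z hz q hq hwq hq0
    · rw [one_smul] at hwq ⊢
      simp only [coord_add] at hwq ⊢
      -- For w = v + z: left of column p, w agrees with z and the old property applies. Right of p,
      -- w vanishes at p, so z would have its leading bit in column p, which has no pivot.
      rcases lt_or_gt_of_ne hqp with hlt | hgt
      · rw [hlead q hlt, zero_add]
        refine h.pivot z hz q hq (fun c hc => ?_) hq0
        have := hwq c hc
        rwa [hlead c (hc.trans hlt), zero_add] at this
      · have hzp : coord z p = 0 := h.pivot z hz p hp (fun c hc => by
          have := hwq c (hc.trans hgt)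
          rwa [hlead c hc, zero_add] at this) hBp
        have := hwq p hgt
        rw [hvp, hzp, add_zero] at this
        exact absurd this one_ne_zero

/-- This counts the values of a new vector that would not raise the rank. -/
theorem card_span (h : Echelon T B out d) :
    Nat.card (Submodule.span (ZMod 2) (out '' Set.Iio d)) = 2 ^ d := by
  have h1 := finrank_span_set_eq_card (R := ZMod 2) (s := out '' Set.Iio d) h.indep.id_image
  rw [Set.toFinset_image, Finset.card_image_of_injOn (by
    simpa using h.indep.injOn)] at h1
  rw [Module.natCard_eq_pow_finrank (K := ZMod 2), Nat.card_zmod, h1]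
  simp

end Echelon

/-! ### The program -/

-- Memory layout. Registers: 0 holds n, 1 holds 2n, 2 stays 0, 3 is the rank, 4 counts samples, 5 is
-- the pivot column, 6 the column in row operations, 7 the qubit, 8 and 9 its two columns, 10 the
-- row whose sign is sought. Arrays: 0 holds the basis found, 1 the signs, 2 the echelon form with
-- row p reserved for pivot p, 3 the current vector, 4 the offset sample, 5 a measured bit.
namespace Cmd

/-- Index register `1` becomes `2 * n`. -/
def doubleLength : Cmd := forLoop 7 0 (seq (inc 1) (inc 1))

/-- Add row `q` of array `b` to row `r` of array `a`. -/
def xorRow (a r b q : ℕ) : Cmd := forLoop 6 1 (xorBit ⟨a, r, 6⟩ ⟨b, q, 6⟩)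

/-- Copy row `q` of array `b` to row `r` of array `a`. -/
def copyRow (a r b q : ℕ) : Cmd :=
  -- There is no copy instruction for bits: adding a cell to itself clears it, and then the source
  -- is added.
  forLoop 6 1 (seq (xorBit ⟨a, r, 6⟩ ⟨a, r, 6⟩) (xorBit ⟨a, r, 6⟩ ⟨b, q, 6⟩))

/-- Row `p` of array `2`, if it has no pivot, and the next row of the output become the current
vector. -/
def addPivot : Cmd :=
  ifBit ⟨2, 5, 5⟩ skip (seq (copyRow 2 5 3 2) (seq (copyRow 0 3 3 2) (inc 3)))

/-- Reduce the vector in array `3` by the echelon form in array `2`, and extend this form and the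
output if the result is not zero. -/
def insertRow : Cmd :=
  -- After `addPivot` row p always has a pivot, so the addition clears column p. If the pivot has
  -- just been created from the current vector, the addition turns that vector into 0.
  forLoop 5 1 (ifBit ⟨3, 2, 5⟩ (seq addPivot (xorRow 3 2 2 5)) skip)

/-- Point index registers `8` and `9` to the two columns of the first qubit. -/
def firstCols : Cmd := seq (zero 8) (seq (zero 9) (inc 9))

/-- Advance index registers `8` and `9` to the next qubit. -/
def nextCols : Cmd := seq (inc 8) (seq (inc 8) (seq (inc 9) (inc 9)))

/-- Measure all pairs of qubits in the Bell basis. -/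
def bellLoop (a : ℕ) : Cmd := forLoop 7 0 (seq (bell 7 ⟨a, 2, 8⟩ ⟨a, 2, 9⟩) nextCols)

/-- Bell sampling; the outcome is put into row `0` of array `a`. -/
def bellSample (a : ℕ) : Cmd := seq loadTwo (seq firstCols (bellLoop a))

/-- Measure a qubit and add the outcome to the sign. -/
def measureAs (a b : ZMod 2) : Cmd := seq (meas a b 7 ⟨5, 2, 2⟩) (xorBit ⟨1, 10, 2⟩ ⟨5, 2, 2⟩)

/-- Measure a qubit in the basis given by the output row. -/
def measureQubit : Cmd :=
  ifBit ⟨0, 10, 8⟩ (ifBit ⟨0, 10, 9⟩ (measureAs 1 1) (measureAs 1 0))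
    (ifBit ⟨0, 10, 9⟩ (measureAs 0 1) (measureAs 0 0))

/-- Measure all qubits in the bases given by the output row. -/
def signLoop : Cmd := forLoop 7 0 (seq measureQubit nextCols)

/-- Find the sign of an output row. -/
def findSign : Cmd := seq loadOne (seq (setBit ⟨1, 10, 2⟩ 0) (seq firstCols signLoop))

/-- Bell sampling, relative to the first sample, followed by an elimination step. -/
def learnRow : Cmd := seq (bellSample 3) (seq (xorRow 3 2 4 2) insertRow)

/-- The learning algorithm. -/
def learner : Cmd :=
  -- The sampling loop runs over register 1, that is 2n times: n halvings offset the initial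
  -- potential 2^n - 1, and n more bring it below 2^(-n).
  seq doubleLength (seq (bellSample 4) (seq (forLoop 4 1 learnRow) (forLoop 10 0 findSign)))

end Cmd

/-! ### Correctness of the classical parts -/

/-- Row `j` of array `a`. -/
def row (s : Config n) (a j : ℕ) : PauliBits n :=
  fun k => (s.bit (a, j, 2 * k), s.bit (a, j, 2 * k + 1))

theorem coord_row (s : Config n) (a j : ℕ) {c : ℕ} (hc : c < 2 * n) :
    coord (row s a j) c = s.bit (a, j, c) := by
  have h : c / 2 < n := by omega
  rw [coord, dif_pos h]
  split_ifs with h2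
  · simp only [row]
    rw [show 2 * (c / 2) = c by omega]
  · simp only [row]
    rw [show 2 * (c / 2) + 1 = c by omega]

theorem row_eq_of_mem_exec {c : Cmd} {s t : Config n} (ht : t ∈ exec ψ c s) {a : ℕ}
    (ha : a ∉ c.arrays) (j : ℕ) : row t a j = row s a j := by
  funext k
  simp only [row, bit_eq_of_mem_exec ht ha]

theorem mem_exec_ifBit {p : BitRef} {c d : Cmd} {s t : Config n} :
    t ∈ exec ψ (.ifBit p c d) s ↔ s.getBit p = 1 ∧ t ∈ exec ψ c (s.tick 1) ∨
      s.getBit p = 0 ∧ t ∈ exec ψ d (s.tick 1) := by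
  rw [exec]
  rcases zmod_two_eq_zero_or_one (s.getBit p) with h | h <;> simp [h]

/-- The invariant says that the columns before the counter are done. The row registers differ from
the counter 6, so the addresses stay fixed, and the arrays differ, so the source stays intact. -/
theorem bit_of_mem_exec_xorRow {a r b q : ℕ} {s t : Config n} (h1 : s.reg 1 = 2 * n)
    (hr : r ≠ 6) (hq : q ≠ 6) (hab : a ≠ b) (ht : t ∈ exec ψ (.xorRow a r b q) s)
    (a' i j : ℕ) : t.bit (a', i, j) = if a' = a ∧ i = s.reg r ∧ j < 2 * n then
      s.bit (a', i, j) + s.bit (b, s.reg q, j) else s.bit (a', i, j) := by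
  have h := forLoop_induction (fun k u => u.reg r = s.reg r ∧ u.reg q = s.reg q ∧
      ∀ a' i j, u.bit (a', i, j) = if a' = a ∧ i = s.reg r ∧ j < k then
        s.bit (a', i, j) + s.bit (b, s.reg q, j) else s.bit (a', i, j))
    ⟨rfl, rfl, by simp⟩ ?_ t ht
  · rw [h1] at h
    exact h.2.2 a' i j
  · rintro k _ u ⟨hur, huq, hu⟩ t' ht'
    rw [exec, Multiset.mem_singleton] at ht'
    subst ht'
    refine ⟨by simpa [hr] using hur, by simpa [hq] using huq, fun a' i j => ?_⟩
    simp only [Config.setBit_bit, Config.addr_eq, Config.tick_bit, Config.setReg_bit,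
      Config.getBit_eq, Config.tick_reg, Config.setReg_reg, Function.update_of_ne hr,
      Function.update_of_ne hq, Function.update_self, hur, huq]
    by_cases hc : a' = a ∧ i = s.reg r ∧ j = k
    · obtain ⟨rfl, rfl, rfl⟩ := hc
      simp [hu, hab.symm]
    · rw [Function.update_of_ne (by simpa using hc), hu]
      have : (a' = a ∧ i = s.reg r ∧ j < k + 1) ↔ (a' = a ∧ i = s.reg r ∧ j < k) := by
        constructor
        · rintro ⟨e1, e2, e3⟩
          exact ⟨e1, e2, by
            by_contra h4
            exact hc ⟨e1, e2, by omega⟩⟩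
        · rintro ⟨e1, e2, e3⟩
          exact ⟨e1, e2, by omega⟩
      simp only [this]

theorem row_of_mem_exec_xorRow {a r b q : ℕ} {s t : Config n} (h1 : s.reg 1 = 2 * n)
    (hr : r ≠ 6) (hq : q ≠ 6) (hab : a ≠ b) (ht : t ∈ exec ψ (.xorRow a r b q) s) :
    row t a = Function.update (row s a) (s.reg r) (row s a (s.reg r) + row s b (s.reg q)) := by
  funext i k
  have e1 : 2 * k.val < 2 * n := by omega
  have e2 : 2 * k.val + 1 < 2 * n := by omega
  simp only [row, bit_of_mem_exec_xorRow h1 hr hq hab ht]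
  by_cases hi : i = s.reg r
  · subst hi
    simp [e1, e2, row]
  · simp [hi, row]

theorem bit_of_mem_exec_copyRow {a r b q : ℕ} {s t : Config n} (h1 : s.reg 1 = 2 * n)
    (hr : r ≠ 6) (hq : q ≠ 6) (hab : a ≠ b) (ht : t ∈ exec ψ (.copyRow a r b q) s)
    (a' i j : ℕ) : t.bit (a', i, j) = if a' = a ∧ i = s.reg r ∧ j < 2 * n then
      s.bit (b, s.reg q, j) else s.bit (a', i, j) := by
  have h := forLoop_induction (fun k u => u.reg r = s.reg r ∧ u.reg q = s.reg q ∧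
      ∀ a' i j, u.bit (a', i, j) = if a' = a ∧ i = s.reg r ∧ j < k then
        s.bit (b, s.reg q, j) else s.bit (a', i, j))
    ⟨rfl, rfl, by simp⟩ ?_ t ht
  · rw [h1] at h
    exact h.2.2 a' i j
  · rintro k _ u ⟨hur, huq, hu⟩ t' ht'
    obtain ⟨u', hu', ht'⟩ := mem_exec_seq.mp ht'
    rw [exec, Multiset.mem_singleton] at hu' ht'
    subst ht' hu'
    refine ⟨by simpa [hr] using hur, by simpa [hq] using huq, fun a' i j => ?_⟩
    simp only [Config.setBit_bit, Config.addr_eq, Config.tick_bit, Config.setReg_bit,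
      Config.getBit_eq, Config.tick_reg, Config.setReg_reg, Function.update_of_ne hr,
      Function.update_of_ne hq, Function.update_self, hur, huq, Config.setBit_reg]
    by_cases hc : a' = a ∧ i = s.reg r ∧ j = k
    · obtain ⟨rfl, rfl, rfl⟩ := hc
      simp [hu, hab.symm, CharTwo.add_self_eq_zero]
    · rw [Function.update_of_ne (by simpa using hc), Function.update_of_ne (by simpa using hc),
        hu]
      have : (a' = a ∧ i = s.reg r ∧ j < k + 1) ↔ (a' = a ∧ i = s.reg r ∧ j < k) := by
        constructor
        · rintro ⟨e1, e2, e3⟩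
          exact ⟨e1, e2, by
            by_contra h4
            exact hc ⟨e1, e2, by omega⟩⟩
        · rintro ⟨e1, e2, e3⟩
          exact ⟨e1, e2, by omega⟩
      simp only [this]

theorem row_of_mem_exec_copyRow {a r b q : ℕ} {s t : Config n} (h1 : s.reg 1 = 2 * n)
    (hr : r ≠ 6) (hq : q ≠ 6) (hab : a ≠ b) (ht : t ∈ exec ψ (.copyRow a r b q) s) :
    row t a = Function.update (row s a) (s.reg r) (row s b (s.reg q)) := by
  funext i k
  have e1 : 2 * k.val < 2 * n := by omega
  have e2 : 2 * k.val + 1 < 2 * n := by omega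
  simp only [row, bit_of_mem_exec_copyRow h1 hr hq hab ht]
  by_cases hi : i = s.reg r
  · subst hi
    simp [e1, e2, row]
  · simp [hi, row]

/-- The span of the output rows. -/
def outSpan (s : Config n) : Submodule (ZMod 2) (PauliBits n) :=
  Submodule.span (ZMod 2) (row s 0 '' Set.Iio (s.reg 3))

/-- The elimination state held by a configuration. -/
def InEchelon (T : Submodule (ZMod 2) (PauliBits n)) (s : Config n) : Prop :=
  Echelon T (row s 2) (row s 0) (s.reg 3)

/-- In both branches column p has a pivot afterwards, as the subsequent reduction requires. The last
clause separates the case where nothing changed from the case where the rank grew. -/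
theorem addPivot_spec {T : Submodule (ZMod 2) (PauliBits n)} {p : ℕ} {s t : Config n}
    (h1 : s.reg 1 = 2 * n) (h2 : s.reg 2 = 0) (h5 : s.reg 5 = p) (hp : p < 2 * n)
    (hs : InEchelon T s) (hv : row s 3 0 ∈ T) (hlead : ∀ c < p, coord (row s 3 0) c = 0)
    (hvp : coord (row s 3 0) p = 1) (ht : t ∈ exec ψ .addPivot s) :
    InEchelon T t ∧ coord (row t 2 p) p = 1 ∧
      (t.reg 3 = s.reg 3 ∧ outSpan t = outSpan s ∨ t.reg 3 = s.reg 3 + 1) := by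
  rcases mem_exec_ifBit.mp ht with ⟨hb, ht⟩ | ⟨hb, ht⟩
  · rw [exec, Multiset.mem_singleton] at ht
    subst ht
    refine ⟨hs, ?_, Or.inl ⟨rfl, rfl⟩⟩
    rw [coord_row _ _ _ hp]
    simpa [h5] using hb
  · obtain ⟨u, hu, ht⟩ := mem_exec_seq.mp ht
    obtain ⟨w, hw, ht⟩ := mem_exec_seq.mp ht
    have u1 : u.reg 1 = 2 * n := (reg_eq_of_mem_exec hu (by decide)).trans h1
    have u2 : u.reg 2 = 0 := (reg_eq_of_mem_exec hu (by decide)).trans h2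
    have u3 : u.reg 3 = s.reg 3 := reg_eq_of_mem_exec hu (by decide)
    have ur2 := row_of_mem_exec_copyRow (s := s.tick 1) (a := 2) (r := 5) (b := 3) (q := 2) h1
        (by decide) (by decide) (by decide) hu
    have ur3 := row_eq_of_mem_exec hu (a := 3) (by decide)
    have ur0 := row_eq_of_mem_exec hu (a := 0) (by decide)
    have w3 : w.reg 3 = u.reg 3 := reg_eq_of_mem_exec hw (by decide)
    have wr0 := row_of_mem_exec_copyRow (a := 0) (r := 3) (b := 3) (q := 2) u1
        (by decide) (by decide) (by decide) hw
    have wr2 := row_eq_of_mem_exec hw (a := 2) (by decide)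
    have t3 : t.reg 3 = w.reg 3 + 1 := by
      rw [exec, Multiset.mem_singleton] at ht
      subst ht
      simp
    have tr0 := row_eq_of_mem_exec ht (a := 0) (by decide)
    have tr2 := row_eq_of_mem_exec ht (a := 2) (by decide)
    have e2 : row t 2 = Function.update (row s 2) p (row s 3 0) := by
      funext i
      rw [tr2, wr2, ur2]
      simp only [Config.tick_reg, h5, h2]
      rfl
    have e0 : row t 0 = Function.update (row s 0) (s.reg 3) (row s 3 0) := by
      funext i
      rw [tr0, wr0, u3, u2, ur3]
      rw [show row u 0 = row s 0 from funext ur0]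
      rfl
    refine ⟨?_, ?_, Or.inr (by rw [t3, w3, u3])⟩
    · rw [InEchelon, e2, e0, t3, w3, u3]
      refine hs.insert hv hp hlead hvp ?_
      rw [coord_row _ _ _ hp]
      simpa [h5] using hb
    · rw [e2, Function.update_self, hvp]

/-- While the rank is unchanged, only vectors of the old span have been added to the current vector.
At the end that vector is 0, so the original vector was in the span. -/
theorem insertRow_spec {T : Submodule (ZMod 2) (PauliBits n)} {s t : Config n}
    (h1 : s.reg 1 = 2 * n) (h2 : s.reg 2 = 0) (hs : InEchelon T s) (hv : row s 3 0 ∈ T)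
    (ht : t ∈ exec ψ .insertRow s) :
    InEchelon T t ∧ s.reg 3 ≤ t.reg 3 ∧ (t.reg 3 = s.reg 3 → row s 3 0 ∈ outSpan s) := by
  have h := forLoop_induction (fun k u => u.reg 1 = 2 * n ∧ u.reg 2 = 0 ∧ InEchelon T u ∧
      row u 3 0 ∈ T ∧ (∀ c < k, coord (row u 3 0) c = 0) ∧ s.reg 3 ≤ u.reg 3 ∧
      (u.reg 3 = s.reg 3 → outSpan u = outSpan s ∧ row u 3 0 + row s 3 0 ∈ outSpan s))
    ⟨h1, h2, hs, hv, by simp, le_rfl, fun _ => ⟨rfl, by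
      rw [show row (s.tick 1) 3 0 = row s 3 0 from rfl, add_self_pauliBits]
      exact zero_mem _⟩⟩ ?_ t ht
  · obtain ⟨_, _, he, _, hz, hle, heq⟩ := h
    refine ⟨he, hle, fun h => ?_⟩
    have := (heq h).2
    rw [h1] at hz
    rwa [eq_zero_of_coord hz, zero_add] at this
  · rintro p hp u ⟨u1, u2, ue, uv, ulead, ule, ueq⟩ t' ht'
    rw [h1] at hp
    rcases mem_exec_ifBit.mp ht' with ⟨hb, ht'⟩ | ⟨hb, ht'⟩
    · have hvp : coord (row u 3 0) p = 1 := by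
        rw [coord_row _ _ _ hp]
        simpa [u2] using hb
      obtain ⟨w, hw, ht'⟩ := mem_exec_seq.mp ht'
      have w1 : w.reg 1 = 2 * n := (reg_eq_of_mem_exec hw (by decide)).trans u1
      have w2 : w.reg 2 = 0 := (reg_eq_of_mem_exec hw (by decide)).trans u2
      have w5 : w.reg 5 = p :=
        (reg_eq_of_mem_exec hw (by decide)).trans (by simp)
      have wr3 : row w 3 0 = row u 3 0 := row_eq_of_mem_exec hw (by decide) 0
      obtain ⟨we, wp, wd⟩ := addPivot_spec (s := ((u.tick 1).setReg 5 p).tick 1) (p := p) u1 u2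
        (by simp) hp ue uv ulead hvp hw
      have tr3 := row_of_mem_exec_xorRow (a := 3) (r := 2) (b := 2) (q := 5) w1
        (by decide) (by decide) (by decide) ht'
      rw [w2, w5, wr3] at tr3
      have tv : row t' 3 0 = row u 3 0 + row w 2 p := by rw [tr3, Function.update_self]
      have t3 : t'.reg 3 = w.reg 3 := reg_eq_of_mem_exec ht' (by decide)
      have tr0 : row t' 0 = row w 0 := funext (row_eq_of_mem_exec ht' (by decide))
      have tr2 : row t' 2 = row w 2 := funext (row_eq_of_mem_exec ht' (by decide))
      have hrow := we.row_mem p hp wp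
      have tspan : outSpan t' = outSpan w := by rw [outSpan, outSpan, tr0, t3]
      refine ⟨(reg_eq_of_mem_exec ht' (by decide)).trans w1,
        (reg_eq_of_mem_exec ht' (by decide)).trans w2, ?_, ?_, ?_, ?_, ?_⟩
      · rw [InEchelon, tr2, tr0, t3]; exact we
      · rw [tv]; exact add_mem uv (we.span_le hrow)
      · intro c hc
        rw [tv, coord_add]
        rcases Nat.lt_succ_iff_lt_or_eq.mp hc with hc | rfl
        · rw [ulead c hc, we.lead p hp wp c hc, add_zero]
        · rw [hvp, wp]; rfl
      · rw [t3]
        rcases wd with ⟨h, _⟩ | h <;> rw [h] <;> simp <;> omega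
      · intro heq
        rw [t3] at heq
        rcases wd with ⟨h, hsp⟩ | h
        · have hsp' : outSpan w = outSpan u := hsp
          obtain ⟨e1, e2⟩ := ueq (h.symm.trans heq)
          rw [tspan, hsp', e1, tv]
          refine ⟨rfl, ?_⟩
          rw [add_right_comm]
          refine add_mem e2 ?_
          rw [← e1, ← hsp']
          exact hrow
        · simp at h
          omega
    · rw [exec, Multiset.mem_singleton] at ht'
      subst ht'
      refine ⟨u1, u2, ue, uv, fun c hc => ?_, ule, ueq⟩
      rcases Nat.lt_succ_iff_lt_or_eq.mp hc with hc | rfl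
      · exact ulead c hc
      · change coord (row u 3 0) c = 0
        rw [coord_row _ _ _ hp]
        simpa [u2] using hb

/-! ### Bell sampling -/

theorem mem_exec_firstCols {s t : Config n} (ht : t ∈ exec ψ .firstCols s) :
    t.reg 8 = 0 ∧ t.reg 9 = 1 ∧ t.vec = s.vec := by
  obtain ⟨u, hu, ht'⟩ := mem_exec_seq.mp ht
  obtain ⟨w, hw, hlast⟩ := mem_exec_seq.mp ht'
  simp only [exec, Multiset.mem_singleton] at hu hw hlast
  rw [hlast, hw, hu]
  simp

theorem mem_exec_nextCols {s t : Config n} (ht : t ∈ exec ψ .nextCols s) :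
    t.reg 8 = s.reg 8 + 2 ∧ t.reg 9 = s.reg 9 + 2 ∧ t.vec = s.vec := by
  obtain ⟨u, hu, ht'⟩ := mem_exec_seq.mp ht
  obtain ⟨w, hw, ht''⟩ := mem_exec_seq.mp ht'
  obtain ⟨x, hx, hlast⟩ := mem_exec_seq.mp ht''
  simp only [exec, Multiset.mem_singleton] at hu hw hx hlast
  rw [hlast, hx, hw, hu]
  simp

theorem mem_exec_bell {i : ℕ} {p q : BitRef} {s t : Config n} (hi : s.reg i < n)
    (ht : t ∈ exec ψ (.bell i p q) s) : ∃ r : ZMod 2 × ZMod 2,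
      t.vec = bellProj ⟨s.reg i, hi⟩ r.1 r.2 s.vec ∧
      t.bit = Function.update (Function.update s.bit (s.addr p) r.1) (s.addr q) r.2 := by
  rw [exec, dif_pos hi] at ht
  obtain ⟨r, _, rfl⟩ := Multiset.mem_map.mp ht
  exact ⟨r, rfl, rfl⟩

/-- After all Bell measurements, only the amplitude at the outcome is left. -/
theorem bellAmp_of_mem_exec_bellLoop {a : ℕ} {s t : Config n} (h0 : s.reg 0 = n)
    (h2 : s.reg 2 = 0) (h8 : s.reg 8 = 0) (h9 : s.reg 9 = 1)
    (ht : t ∈ exec ψ (.bellLoop a) s) (r : PauliBits n) :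
    bellAmp r t.vec = if r = row t a 0 then bellAmp r s.vec else 0 := by
  -- After k measurements an amplitude survives exactly when its label agrees with the recorded
  -- outcomes on the first k qubits.
  have h := forLoop_induction (fun k u => u.reg 2 = 0 ∧ u.reg 8 = 2 * k ∧ u.reg 9 = 2 * k + 1 ∧
      ∀ r, bellAmp r u.vec =
        if ∀ i : Fin n, i.val < k → r i = row u a 0 i then bellAmp r s.vec else 0)
    ⟨h2, h8, h9, by simp⟩ ?_ t ht
  · rw [h.2.2.2 r, h0]
    simp [funext_iff]
  · rintro k hk u ⟨u2, u8, u9, hu⟩ t' ht'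
    rw [h0] at hk
    obtain ⟨w, hw, ht'⟩ := mem_exec_seq.mp ht'
    obtain ⟨t8, t9, tv⟩ := mem_exec_nextCols ht'
    have w2 : w.reg 2 = u.reg 2 := reg_eq_of_mem_exec hw (by simp [Cmd.regs])
    have w8 : w.reg 8 = u.reg 8 := reg_eq_of_mem_exec hw (by simp [Cmd.regs])
    have w9 : w.reg 9 = u.reg 9 := reg_eq_of_mem_exec hw (by simp [Cmd.regs])
    have t2 : t'.reg 2 = w.reg 2 := reg_eq_of_mem_exec ht' (by decide)
    have trow : row t' a 0 = row w a 0 :=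
      row_eq_of_mem_exec ht' (by simp [Cmd.arrays, Cmd.nextCols]) 0
    refine ⟨by omega, by omega, by omega, fun r => ?_⟩
    rw [tv, trow]
    obtain ⟨q, wv, wbit⟩ := mem_exec_bell (by simpa using hk) hw
    have hrow : ∀ i : Fin n, row w a 0 i = if i.val = k then q else row u a 0 i := by
      intro i
      have e1 : ∀ j : ℕ, 2 * j + 1 ≠ 2 * k := by intro j; omega
      have e2 : ∀ j : ℕ, 2 * j ≠ 2 * k + 1 := by intro j; omega
      simp only [row, wbit, Config.addr_eq, Config.setReg_reg, Config.tick_reg,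
        Config.tick_bit, Config.setReg_bit]
      by_cases hi : i.val = k
      · simp [hi, u2, u8, u9]
      · simp [hi, u2, u8, u9, e1, e2]
    rw [wv, bellAmp_bellProj]
    simp only [hrow, Config.setReg_vec, Config.tick_vec, hu, Config.setReg_reg,
      Function.update_self]
    rw [← ite_and]
    refine if_congr ?_ rfl rfl
    constructor
    · rintro ⟨e1, e2⟩ i hi
      split_ifs with hik
      · rw [show i = ⟨k, hk⟩ from Fin.ext hik]; exact e1
      · exact e2 i (by omega)
    · intro e
      refine ⟨?_, fun i hi => ?_⟩
      · have := e ⟨k, hk⟩ (Nat.lt_succ_self k)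
        simpa using this
      · have := e i (by omega)
        rwa [if_neg (by omega)] at this

/-- Parseval in the Bell basis: a single amplitude is left, the one at the recorded outcome. -/
theorem bellLoop_weight {a : ℕ} {s t : Config n} (h0 : s.reg 0 = n)
    (h2 : s.reg 2 = 0) (h8 : s.reg 8 = 0) (h9 : s.reg 9 = 1)
    (ht : t ∈ exec ψ (.bellLoop a) s) :
    t.weight = s.prob * ‖bellAmp (row t a 0) s.vec‖ ^ 2 := by
  have hp : t.prob = s.prob :=
    prob_eq_of_mem_exec ht (by simp [Cmd.bellLoop, Cmd.nextCols, Cmd.NoLoad])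
  rw [Config.weight_eq, hp, ← sum_norm_sq_bellAmp, Finset.sum_eq_single (row t a 0)]
  · rw [bellAmp_of_mem_exec_bellLoop h0 h2 h8 h9 ht, if_pos rfl]
  · intro r _ hr
    rw [bellAmp_of_mem_exec_bellLoop h0 h2 h8 h9 ht, if_neg hr]
    simp
  · simp

open Classical in
/-- The probability that the outcome of the Bell measurements is in `D`. -/
theorem expect_bellLoop {a : ℕ} {s : Config n} (h0 : s.reg 0 = n)
    (h2 : s.reg 2 = 0) (h8 : s.reg 8 = 0) (h9 : s.reg 9 = 1) (D : Finset (PauliBits n)) :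
    expect ψ (.bellLoop a) (fun t => if row t a 0 ∈ D then 1 else 0) s =
      s.prob * ∑ r ∈ D, ‖bellAmp r s.vec‖ ^ 2 := by
  have hB : (Cmd.bellLoop a).BellOnly := by simp [Cmd.bellLoop, Cmd.nextCols, Cmd.BellOnly]
  -- The mass on `D` is conserved by Bell measurements. On a final branch it equals the whole weight
  -- or 0, according to the recorded outcome.
  rw [← sum_map_exec (ψ := ψ) (f := fun p v => p * ∑ r ∈ D, ‖bellAmp r v‖ ^ 2)
    (fun p i v => by rw [← Finset.mul_sum, sum_bellAmp_bellProj]) (fun h => (h hB).elim) s,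
    expect]
  congr 1
  refine Multiset.map_congr rfl fun t ht => ?_
  have hp : t.prob = s.prob :=
    prob_eq_of_mem_exec ht (by simp [Cmd.bellLoop, Cmd.nextCols, Cmd.NoLoad])
  rw [bellLoop_weight h0 h2 h8 h9 ht, hp]
  simp_rw [bellAmp_of_mem_exec_bellLoop h0 h2 h8 h9 ht]
  split_ifs with h
  · rw [Finset.sum_eq_single_of_mem _ h fun r _ hr => by simp [hr]]
    simp
  · rw [Finset.sum_eq_zero]
    · simp
    · intro r hr
      have : r ≠ row t a 0 := fun e => h (e ▸ hr)
      simp [this]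

theorem prob_eq_of_mem_exec_firstCols {s t : Config n} (ht : t ∈ exec ψ .firstCols s) :
    t.prob = s.prob :=
  prob_eq_of_mem_exec ht (by simp [Cmd.firstCols, Cmd.NoLoad])

/-- Outcomes of Bell sampling have a nonzero Hilbert–Schmidt product with the state. -/
theorem pauliCoeff_ne_zero_of_runs {a : ℕ} {s t : Config n} (h0 : s.reg 0 = n)
    (h2 : s.reg 2 = 0) (ht : Runs ψ (.bellSample a) s t) :
    pauliCoeff (row t a 0) (fun x y => ψ x * ψ y) ≠ 0 := by
  obtain ⟨ht1, hw⟩ := ht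
  obtain ⟨u, hu, ht2⟩ := mem_exec_seq.mp ht1
  obtain ⟨w, hfirst, ht3⟩ := mem_exec_seq.mp ht2
  obtain ⟨w8, w9, wv⟩ := mem_exec_firstCols hfirst
  rw [exec, Multiset.mem_singleton] at hu
  have u0 : u.reg 0 = n := by rw [hu]; exact h0
  have u2 : u.reg 2 = 0 := by rw [hu]; exact h2
  rw [bellLoop_weight ((reg_eq_of_mem_exec hfirst (by decide)).trans u0)
    ((reg_eq_of_mem_exec hfirst (by decide)).trans u2) w8 w9 ht3, norm_sq_bellAmp, wv, hu] at hw
  intro h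
  rw [Config.load_vec, h] at hw
  simp at hw

-- Each outcome has probability at most 2^(-n), and these bounds are summed over `D`.
open Classical in
theorem expect_bellSample_le (hψ : ∑ x, ‖ψ x‖ ^ 2 = 1) {a : ℕ} {s : Config n}
    (hs : 0 ≤ s.weight) (h0 : s.reg 0 = n) (h2 : s.reg 2 = 0) (D : Finset (PauliBits n)) :
    expect ψ (.bellSample a) (fun t => if row t a 0 ∈ D then 1 else 0) s ≤
      s.weight * (D.card / 2 ^ n) := by
  have hbound : ∑ r ∈ D, ‖bellAmp r fun x y => ψ x * ψ y‖ ^ 2 ≤ (D.card / 2 ^ n : ℝ) := by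
    rw [div_eq_mul_inv, ← nsmul_eq_mul]
    refine Finset.sum_le_card_nsmul _ _ _ fun r _ => ?_
    rw [norm_sq_bellAmp, ← one_div]
    gcongr
    exact norm_sq_pauliCoeff_self_le hψ r
  rw [Cmd.bellSample, expect_seq, exec, Multiset.map_singleton, Multiset.sum_singleton,
    expect_seq]
  have hfirst : ∀ w ∈ exec ψ .firstCols ((s.tick (2 * n + 1)).load ψ ψ 2),
      expect ψ (.bellLoop a) (fun t => if row t a 0 ∈ D then 1 else 0) w =
        s.weight * ∑ r ∈ D, ‖bellAmp r fun x y => ψ x * ψ y‖ ^ 2 := by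
    intro w hw
    obtain ⟨w8, w9, wv⟩ := mem_exec_firstCols hw
    rw [expect_bellLoop ((reg_eq_of_mem_exec hw (by decide)).trans h0)
      ((reg_eq_of_mem_exec hw (by decide)).trans h2) w8 w9, wv,
      prob_eq_of_mem_exec_firstCols hw]
    rfl
  rw [Multiset.map_congr rfl hfirst]
  -- Setting the column registers is deterministic, so there is exactly one branch.
  have hcard : (exec ψ .firstCols ((s.tick (2 * n + 1)).load ψ ψ 2)).card = 1 := by
    simp [Cmd.firstCols, exec]
  rw [Multiset.map_const', hcard, Multiset.replicate_one, Multiset.sum_singleton]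
  exact mul_le_mul_of_nonneg_left hbound hs

/-! ### Signs -/

/-- The effect of measuring a qubit in a fixed basis. -/
theorem mem_exec_measureAs {a b : ZMod 2} {i j : ℕ} {s t : Config n} (h2 : s.reg 2 = 0)
    (h7 : s.reg 7 = i) (h10 : s.reg 10 = j) (hi : i < n)
    (ht : t ∈ exec ψ (.measureAs a b) s) :
    ∃ e, t.vec = pauliProj ⟨i, hi⟩ a b e s.vec ∧ t.bit (1, j, 0) = s.bit (1, j, 0) + e := by
  subst h7 h10
  obtain ⟨u, hu, ht'⟩ := mem_exec_seq.mp ht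
  rw [exec, dif_pos hi] at hu
  rw [exec, Multiset.mem_singleton] at ht'
  obtain ⟨e, _, rfl⟩ := Multiset.mem_map.mp hu
  rw [ht']
  exact ⟨e, rfl, by simp [Config.setBit, Config.addr, Config.getBit, h2]⟩

/-- The effect of measuring a qubit in the basis given by an output row. -/
theorem mem_exec_measureQubit {i j : ℕ} {s t : Config n} (h2 : s.reg 2 = 0)
    (h7 : s.reg 7 = i) (h8 : s.reg 8 = 2 * i) (h9 : s.reg 9 = 2 * i + 1) (h10 : s.reg 10 = j)
    (hi : i < n) (ht : t ∈ exec ψ .measureQubit s) :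
    ∃ e, t.vec = pauliProj ⟨i, hi⟩ (row s 0 j ⟨i, hi⟩).1 (row s 0 j ⟨i, hi⟩).2 e s.vec ∧
      t.bit (1, j, 0) = s.bit (1, j, 0) + e := by
  rcases mem_exec_ifBit.mp ht with ⟨hb, ht⟩ | ⟨hb, ht⟩ <;>
  rcases mem_exec_ifBit.mp ht with ⟨hb', ht⟩ | ⟨hb', ht⟩ <;>
  · simp only [Config.getBit_eq, h10, h8, h9, Config.tick_reg, Config.tick_bit] at hb hb'
    simp only [row, hb, hb']
    exact mem_exec_measureAs (s := (s.tick 1).tick 1) h2 h7 h10 hi ht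

/-- Two eigenvalue equations are carried along: the full Pauli operator keeps the sign `e` because
each measurement commutes with it, and the prefix operator has the recorded parity as its sign.
After n qubits the two operators coincide. -/
theorem signLoop_spec {j : ℕ} {e : ZMod 2} {s t : Config n} (h0 : s.reg 0 = n)
    (h2 : s.reg 2 = 0) (h8 : s.reg 8 = 0) (h9 : s.reg 9 = 1) (h10 : s.reg 10 = j)
    (hbit : s.bit (1, j, 0) = 0)
    (hs : onFirst (tensor fun k => pauli (row s 0 j k).1 (row s 0 j k).2) s.vec =
      (-1 : ℂ) ^ e.val • s.vec)
    (ht : t ∈ exec ψ .signLoop s) :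
    onFirst (tensor fun k => pauli (row s 0 j k).1 (row s 0 j k).2) t.vec =
        (-1 : ℂ) ^ e.val • t.vec ∧
      onFirst (tensor fun k => pauli (row s 0 j k).1 (row s 0 j k).2) t.vec =
        (-1 : ℂ) ^ (t.bit (1, j, 0)).val • t.vec := by
  rw [← prefixPauli_self] at hs ⊢
  have h := forLoop_induction (fun k u => u.reg 2 = 0 ∧ u.reg 8 = 2 * k ∧ u.reg 9 = 2 * k + 1 ∧
      u.reg 10 = j ∧ row u 0 j = row s 0 j ∧
      onFirst (prefixPauli (row s 0 j) n) u.vec = (-1 : ℂ) ^ e.val • u.vec ∧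
      onFirst (prefixPauli (row s 0 j) k) u.vec =
        (-1 : ℂ) ^ (u.bit (1, j, 0)).val • u.vec)
    ⟨h2, h8, h9, h10, rfl, hs, by
      rw [prefixPauli_zero, onFirst_one, Config.tick_bit, hbit, ZMod.val_zero, pow_zero,
        one_smul]⟩ ?_ t ht
  · rw [h0] at h
    exact ⟨h.2.2.2.2.2.1, h.2.2.2.2.2.2⟩
  · rintro k hk u ⟨u2, u8, u9, u10, urow, ufull, upre⟩ t' ht'
    rw [h0] at hk
    obtain ⟨w, hw, ht'⟩ := mem_exec_seq.mp ht'
    obtain ⟨t8, t9, tv⟩ := mem_exec_nextCols ht'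
    have w2 : w.reg 2 = u.reg 2 := reg_eq_of_mem_exec hw (by decide)
    have w8 : w.reg 8 = u.reg 8 := reg_eq_of_mem_exec hw (by decide)
    have w9 : w.reg 9 = u.reg 9 := reg_eq_of_mem_exec hw (by decide)
    have w10 : w.reg 10 = u.reg 10 := reg_eq_of_mem_exec hw (by decide)
    have wrow : row w 0 j = row u 0 j := row_eq_of_mem_exec hw (by decide) j
    have t2 : t'.reg 2 = w.reg 2 := reg_eq_of_mem_exec ht' (by decide)
    have t10 : t'.reg 10 = w.reg 10 := reg_eq_of_mem_exec ht' (by decide)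
    have trow : row t' 0 j = row w 0 j := row_eq_of_mem_exec ht' (by decide) j
    have tbit : t'.bit (1, j, 0) = w.bit (1, j, 0) := bit_eq_of_mem_exec ht' (by decide) _ _
    obtain ⟨e', wv, wbit⟩ := mem_exec_measureQubit (s := (u.tick 1).setReg 7 k) (i := k) (j := j)
      u2 (by simp) u8 u9 u10 hk hw
    have hrow' : row ((u.tick 1).setReg 7 k) 0 j = row s 0 j := urow
    rw [hrow'] at wv
    refine ⟨by omega, by omega, by omega, by omega, by rw [trow, wrow, urow], ?_, ?_⟩
    · rw [tv, wv]
      exact onFirst_pauliProj_of_commute (prefixPauli_commute _ _ _) ufull _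
    · rw [tv, wv, tbit, wbit]
      exact onFirst_prefixPauli_succ (i := ⟨k, hk⟩) upre e'

theorem bit_of_mem_exec_measureAs {a b : ZMod 2} {j : ℕ} {s t : Config n}
    (hj : j ≠ s.reg 10) (ht : t ∈ exec ψ (.measureAs a b) s) (c : ℕ) :
    t.bit (1, j, c) = s.bit (1, j, c) := by
  obtain ⟨u, hu, ht'⟩ := mem_exec_seq.mp ht
  have u10 : u.reg 10 = s.reg 10 := reg_eq_of_mem_exec hu (by simp [Cmd.regs])
  rw [exec, Multiset.mem_singleton] at ht'
  rw [ht', ← bit_eq_of_mem_exec hu (by simp [Cmd.arrays])]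
  simp [u10, hj]

/-- Finding the sign of a row does not change the other signs. -/
theorem bit_of_mem_exec_findSign {j : ℕ} {s t : Config n} (hj : j ≠ s.reg 10)
    (ht : t ∈ exec ψ .findSign s) : t.bit (1, j, 0) = s.bit (1, j, 0) := by
  obtain ⟨u, hu, ht2⟩ := mem_exec_seq.mp ht
  obtain ⟨w, hset, ht3⟩ := mem_exec_seq.mp ht2
  obtain ⟨x, hfirst, ht4⟩ := mem_exec_seq.mp ht3
  simp only [exec, Multiset.mem_singleton] at hu hset
  have x10 : x.reg 10 = s.reg 10 := by
    rw [reg_eq_of_mem_exec hfirst (by decide), hset, hu]; rfl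
  have xbit : x.bit (1, j, 0) = s.bit (1, j, 0) := by
    rw [bit_eq_of_mem_exec hfirst (by decide), hset, hu]
    simp [hj]
  rw [← xbit]
  refine (forLoop_induction (fun _ v => v.reg 10 = x.reg 10 ∧
    v.bit (1, j, 0) = x.bit (1, j, 0)) ⟨rfl, rfl⟩ ?_ t ht4).2
  rintro k _ v ⟨v10, vbit⟩ t' ht'
  obtain ⟨y, hy, hnext⟩ := mem_exec_seq.mp ht'
  have hjv : j ≠ v.reg 10 := by rw [v10, x10]; exact hj
  refine ⟨?_, ?_⟩
  · rw [reg_eq_of_mem_exec hnext (by decide), reg_eq_of_mem_exec hy (by decide), ← v10]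
    simp
  · rw [bit_eq_of_mem_exec hnext (by decide), ← vbit]
    rcases mem_exec_ifBit.mp hy with ⟨_, hy⟩ | ⟨_, hy⟩ <;>
    rcases mem_exec_ifBit.mp hy with ⟨_, hy⟩ | ⟨_, hy⟩ <;>
    · exact bit_of_mem_exec_measureAs (by simpa using hjv) hy 0

theorem vec_ne_zero_of_weight_pos {s : Config n} (hs : 0 < s.weight) : s.vec ≠ 0 := by
  intro h
  rw [Config.weight_eq, h] at hs
  simp [normSq] at hs

/-- The sign found for an output row in the stabilizer is correct. -/
theorem findSign_spec (hψ : ∑ x, ‖ψ x‖ ^ 2 = 1) {j : ℕ} {s t : Config n} (h0 : s.reg 0 = n)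
    (h2 : s.reg 2 = 0) (h10 : s.reg 10 = j) (hrow : row s 0 j ∈ stabilizerSpace ψ)
    (ht : Runs ψ .findSign s t) :
    (SignedPauli.toMatrix (t.bit (1, j, 0), row s 0 j)).mulVec ψ = ψ := by
  obtain ⟨ht1, hw⟩ := ht
  obtain ⟨u, hu, ht2⟩ := mem_exec_seq.mp ht1
  obtain ⟨w, hset, ht3⟩ := mem_exec_seq.mp ht2
  obtain ⟨x, hfirst, ht4⟩ := mem_exec_seq.mp ht3
  obtain ⟨x8, x9, xv⟩ := mem_exec_firstCols hfirst
  simp only [exec, Multiset.mem_singleton] at hu hset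
  obtain ⟨e, he⟩ := exists_sign_of_mem_stabilizerSpace (ne_zero_of_sum_norm_sq hψ) hrow
  have xrow : row x 0 j = row s 0 j := by
    rw [row_eq_of_mem_exec hfirst (by decide), hset, hu]
    funext k
    simp [row]
  have xvec : onFirst (tensor fun k => pauli (row x 0 j k).1 (row x 0 j k).2) x.vec =
      (-1 : ℂ) ^ e.val • x.vec := by
    rw [xv, hset, hu, xrow]
    simp only [Config.setBit_vec, Config.tick_vec, Config.load_vec, onFirst_product]
    rw [he]
    funext y z
    simp
  have x0 : x.reg 0 = n := by
    rw [reg_eq_of_mem_exec hfirst (by decide), hset, hu]; exact h0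
  have x2 : x.reg 2 = 0 := by
    rw [reg_eq_of_mem_exec hfirst (by decide), hset, hu]; exact h2
  have x10 : x.reg 10 = j := by
    rw [reg_eq_of_mem_exec hfirst (by decide), hset, hu]; exact h10
  have xbit : x.bit (1, j, 0) = 0 := by
    rw [bit_eq_of_mem_exec hfirst (by decide), hset, hu]
    simp [h10, h2]
  obtain ⟨h3, h4⟩ := signLoop_spec x0 x2 x8 x9 x10 xbit xvec ht4
  -- A branch of positive weight has a nonzero vector, so its two eigenvalues for the same operator
  -- agree.
  have h5 : (-1 : ℂ) ^ e.val = (-1 : ℂ) ^ (t.bit (1, j, 0)).val :=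
    smul_left_injective ℂ (vec_ne_zero_of_weight_pos hw) (h3.symm.trans h4)
  rw [toMatrix_eq_smul_tensor, Matrix.smul_mulVec, he, smul_smul, h5,
    neg_one_pow_val_mul_self, one_smul]

theorem findSigns_spec (hψ : ∑ x, ‖ψ x‖ ^ 2 = 1) {s t : Config n} (h0 : s.reg 0 = n)
    (h2 : s.reg 2 = 0) (hrow : ∀ j < n, row s 0 j ∈ stabilizerSpace ψ)
    (ht : Runs ψ (.forLoop 10 0 .findSign) s t) (j : Fin n) :
    (t.output j).toMatrix.mulVec ψ = ψ ∧ (t.output j).2 = row s 0 j := by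
  have h := ht.forLoop hψ (fun k u => u.reg 0 = n ∧ u.reg 2 = 0 ∧
      (∀ j, row u 0 j = row s 0 j) ∧ ∀ j < k,
        (SignedPauli.toMatrix (u.bit (1, j, 0), row s 0 j)).mulVec ψ = ψ)
    ⟨h0, h2, fun _ => rfl, by simp⟩ ?_
  · rw [h0] at h
    obtain ⟨_, _, hr, hs⟩ := h
    have e : (t.output j).2 = row s 0 j := hr j
    refine ⟨?_, e⟩
    have := hs j j.2
    rw [← e] at this
    exact this
  · rintro k hk u ⟨u0, u2, ur, us⟩ t' ht'
    rw [h0] at hk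
    refine ⟨(reg_eq_of_mem_exec ht'.1 (by decide)).trans u0,
      (reg_eq_of_mem_exec ht'.1 (by decide)).trans u2,
      fun j => (row_eq_of_mem_exec ht'.1 (by decide) j).trans (ur j), ?_⟩
    intro j hj
    rcases Nat.lt_succ_iff_lt_or_eq.mp hj with hj | rfl
    · have hbit : t'.bit (1, j, 0) = u.bit (1, j, 0) :=
        bit_of_mem_exec_findSign (s := (u.tick 1).setReg 10 k) (by simpa using hj.ne) ht'.1
      rw [hbit]
      exact us j hj
    · have hj' : row ((u.tick 1).setReg 10 j) 0 j = row s 0 j := ur j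
      have h := findSign_spec (s := (u.tick 1).setReg 10 j) (j := j) hψ u0 u2 (by simp)
        (by rw [hj']; exact hrow j hk) ht'
      rw [hj'] at h
      exact h

/-! ### Success probability -/

/-- The number of hyperplanes of an `n`-dimensional space over `𝔽₂` that contain a given
`d`-dimensional subspace. -/
noncomputable def hyperplanes (n d : ℕ) : ℝ := 2 ^ (n - d) - 1

theorem hyperplanes_antitone {d e : ℕ} (h : d ≤ e) : hyperplanes n e ≤ hyperplanes n d := by
  unfold hyperplanes
  gcongr
  norm_num

/-- The bracket bounds the expected potential when the rank stays at d with probability at most 2^d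
/ 2^n and grows otherwise. For d < n the inequality is an equality, as for a uniform vector, which
lies in any given hyperplane with probability 1/2. For d ≥ n truncated subtraction makes every term
0. -/
theorem hyperplanes_step (n d : ℕ) :
    2 * (hyperplanes n (d + 1) + 2 ^ d / 2 ^ n * (hyperplanes n d - hyperplanes n (d + 1))) ≤
      hyperplanes n d := by
  unfold hyperplanes
  rcases le_or_gt n d with h | h
  · rw [Nat.sub_eq_zero_of_le h, Nat.sub_eq_zero_of_le (h.trans d.le_succ)]
    norm_num
  · obtain ⟨m, rfl⟩ : ∃ m, n = d + (m + 1) := ⟨n - d - 1, by omega⟩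
    rw [show d + (m + 1) - d = m + 1 by omega, show d + (m + 1) - (d + 1) = m by omega,
      pow_add, pow_succ]
    have h1 : (2 : ℝ) ^ d ≠ 0 := by positivity
    have h2 : (2 : ℝ) ^ m ≠ 0 := by positivity
    apply le_of_eq
    field_simp
    ring

/-- What holds after each row that the program learns. -/
structure LearnInv (ψ : Bits n → ℂ) (s : Config n) : Prop where
  reg_zero : s.reg 0 = n
  reg_one : s.reg 1 = 2 * n
  reg_two : s.reg 2 = 0
  offset : pauliCoeff (row s 4 0) (fun x y => ψ x * ψ y) ≠ 0
  echelon : InEchelon (stabilizerSpace ψ) s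

/-- The sum of the sample and the offset lies in the stabilizer because both are possible Bell
outcomes. If the rank does not grow, the sum was already in the old span. -/
theorem learnRow_tail {s t u : Config n} (hψ : IsStabilizerState ψ) (hs : LearnInv ψ s)
    (ht : Runs ψ (.bellSample 3) s t)
    (hu : Runs ψ (.seq (.xorRow 3 2 4 2) .insertRow) t u) :
    LearnInv ψ u ∧ s.reg 3 ≤ u.reg 3 ∧
      (u.reg 3 = s.reg 3 → row t 3 0 + row s 4 0 ∈ outSpan s) := by
  have ht' := ht.1
  obtain ⟨w, hw, hu'⟩ := mem_exec_seq.mp hu.1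
  have t0 : t.reg 0 = n := (reg_eq_of_mem_exec ht' (by decide)).trans hs.reg_zero
  have t1 : t.reg 1 = 2 * n := (reg_eq_of_mem_exec ht' (by decide)).trans hs.reg_one
  have t2 : t.reg 2 = 0 := (reg_eq_of_mem_exec ht' (by decide)).trans hs.reg_two
  have t3 : t.reg 3 = s.reg 3 := reg_eq_of_mem_exec ht' (by decide)
  have tr0 : row t 0 = row s 0 := funext (row_eq_of_mem_exec ht' (by decide))
  have tr2 : row t 2 = row s 2 := funext (row_eq_of_mem_exec ht' (by decide))
  have tr4 : row t 4 = row s 4 := funext (row_eq_of_mem_exec ht' (by decide))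
  have w0 : w.reg 0 = n := (reg_eq_of_mem_exec hw (by decide)).trans t0
  have w1 : w.reg 1 = 2 * n := (reg_eq_of_mem_exec hw (by decide)).trans t1
  have w2 : w.reg 2 = 0 := (reg_eq_of_mem_exec hw (by decide)).trans t2
  have w3 : w.reg 3 = s.reg 3 := (reg_eq_of_mem_exec hw (by decide)).trans t3
  have wr0 : row w 0 = row s 0 := (funext (row_eq_of_mem_exec hw (by decide))).trans tr0
  have wr2 : row w 2 = row s 2 := (funext (row_eq_of_mem_exec hw (by decide))).trans tr2
  have wr4 : row w 4 = row s 4 := (funext (row_eq_of_mem_exec hw (by decide))).trans tr4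
  have wr3 : row w 3 0 = row t 3 0 + row s 4 0 := by
    have h := row_of_mem_exec_xorRow (a := 3) (r := 2) (b := 4) (q := 2) t1 (by decide)
      (by decide) (by decide) hw
    rw [h, t2, Function.update_self, tr4]
  have we : InEchelon (stabilizerSpace ψ) w := by
    rw [InEchelon, wr2, wr0, w3]
    exact hs.echelon
  have wv : row w 3 0 ∈ stabilizerSpace ψ := by
    rw [wr3]
    exact add_mem_stabilizerSpace hψ
      (pauliCoeff_ne_zero_of_runs hs.reg_zero hs.reg_two ht) hs.offset
  obtain ⟨ue, hle, heq⟩ := insertRow_spec w1 w2 we wv hu'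
  have ur4 : row u 4 = row w 4 := funext (row_eq_of_mem_exec hu' (by decide))
  refine ⟨⟨(reg_eq_of_mem_exec hu' (by decide)).trans w0,
    (reg_eq_of_mem_exec hu' (by decide)).trans w1,
    (reg_eq_of_mem_exec hu' (by decide)).trans w2, ?_, ue⟩, w3 ▸ hle, fun h => ?_⟩
  · rw [ur4, wr4]; exact hs.offset
  · have := heq (h.trans w3.symm)
    rwa [wr3, outSpan, wr0, w3] at this

theorem learnRow_inv {s u : Config n} (hψ : IsStabilizerState ψ) (hs : LearnInv ψ s)
    (hu : Runs ψ .learnRow s u) : LearnInv ψ u := by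
  obtain ⟨t, ht, hu⟩ := hu.seq hψ.1
  exact (learnRow_tail hψ hs ht hu).1

theorem expect_const_add_mul (hψ : ∑ x, ‖ψ x‖ ^ 2 = 1) (c : Cmd) (a b : ℝ)
    (f : Config n → ℝ) (s : Config n) :
    expect ψ c (fun t => a + f t * b) s = s.weight * a + expect ψ c f s * b := by
  rw [← expect_const hψ c a s, expect, expect, expect, ← Multiset.sum_map_mul_right,
    ← Multiset.sum_map_add]
  congr 1
  refine Multiset.map_congr rfl fun t _ => ?_
  ring

open Classical in
/-- A new row halves the expected number of hyperplanes that contain all rows. -/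
theorem expect_learnRow_le (hψ : IsStabilizerState ψ) {s : Config n} (hw : 0 ≤ s.weight)
    (hs : LearnInv ψ s) :
    expect ψ .learnRow (fun u => hyperplanes n (u.reg 3)) s ≤
      s.weight * (hyperplanes n (s.reg 3) / 2) := by
  set d := s.reg 3 with hd
  -- The useless outcomes form a translate of the current span by the offset, so there are 2^d of
  -- them.
  let D : Finset (PauliBits n) := Finset.univ.filter fun r => r + row s 4 0 ∈ outSpan s
  have hD : D.card = 2 ^ d := by
    have hcard := hs.echelon.card_span
    rw [← hd, Nat.card_eq_fintype_card, Fintype.card_subtype] at hcard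
    rw [← hcard]
    refine Finset.card_bij (fun r _ => r + row s 4 0) ?_ ?_ ?_
    · intro r hr
      exact Finset.mem_filter.mpr ⟨Finset.mem_univ _, (Finset.mem_filter.mp hr).2⟩
    · intro r _ r' _ h
      exact add_right_cancel h
    · intro r hr
      refine ⟨r + row s 4 0, ?_, by rw [add_assoc, add_self_pauliBits, add_zero]⟩
      simp only [D, Finset.mem_filter, Finset.mem_univ, true_and]
      rw [add_assoc, add_self_pauliBits, add_zero]
      exact (Finset.mem_filter.mp hr).2
  have hdiff : 0 ≤ hyperplanes n d - hyperplanes n (d + 1) :=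
    sub_nonneg.mpr (hyperplanes_antitone d.le_succ)
  have h1 : expect ψ .learnRow (fun u => hyperplanes n (u.reg 3)) s ≤
      expect ψ (.bellSample 3) (fun t => hyperplanes n (d + 1) +
        (if row t 3 0 ∈ D then 1 else 0) * (hyperplanes n d - hyperplanes n (d + 1))) s := by
    refine expect_seq_le hψ.1 hw fun t ht => ?_
    refine expect_le_const hψ.1 ht.2.le fun u hu => ?_
    obtain ⟨_, hle, heq⟩ := learnRow_tail hψ hs ht hu
    split_ifs with h
    · rw [one_mul, add_sub_cancel]
      exact hyperplanes_antitone hle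
    · rw [zero_mul, add_zero]
      refine hyperplanes_antitone ?_
      rcases hle.eq_or_lt with h2 | h2
      · exact absurd (by simpa [D] using heq h2.symm) h
      · exact h2
  have h2 := expect_bellSample_le (a := 3) hψ.1 hw hs.reg_zero hs.reg_two D
  rw [expect_const_add_mul hψ.1] at h1
  have h3 := mul_le_mul_of_nonneg_right h2 hdiff
  have h4 := mul_le_mul_of_nonneg_left (hyperplanes_step n d) hw
  rw [hD] at h3
  push_cast at h3
  nlinarith

theorem doubleLength_spec {s t : Config n} (h0 : s.reg 0 = n) (h1 : s.reg 1 = 0)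
    (ht : t ∈ exec ψ .doubleLength s) : t.reg 1 = 2 * n := by
  have h := forLoop_induction (fun k u => u.reg 1 = 2 * k) h1 ?_ t ht
  · rw [h0] at h; exact h
  · intro k _ u hu t' ht'
    obtain ⟨w, hw, hlast⟩ := mem_exec_seq.mp ht'
    simp only [exec, Multiset.mem_singleton] at hw hlast
    rw [hlast, hw]
    simp [hu, Nat.mul_succ]

open Classical in
/-- The indicator of failure. -/
noncomputable def failure (ψ : Bits n → ℂ) (s : Config n) : ℝ :=
  if Identifies s.output ψ then 0 else 1

/-- The potential dominates the failure indicator: below rank n it is at least 1, and from rank n on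
the output identifies ψ in every possible branch. -/
theorem expect_findSigns_le (hψ : IsStabilizerState ψ) {s : Config n} (hw : 0 ≤ s.weight)
    (hs : LearnInv ψ s) :
    expect ψ (.forLoop 10 0 .findSign) (failure ψ) s ≤
      s.weight * hyperplanes n (s.reg 3) := by
  refine expect_le_const hψ.1 hw fun t ht => ?_
  rcases lt_or_ge (s.reg 3) n with h | h
  · have h1 : (2 : ℝ) ^ 1 ≤ 2 ^ (n - s.reg 3) :=
      pow_le_pow_right₀ (by norm_num) (by omega)
    have h2 : failure ψ t ≤ 1 := by unfold failure; split_ifs <;> norm_num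
    unfold hyperplanes
    linarith
  · have hsign := findSigns_spec hψ.1 hs.reg_zero hs.reg_two
      (fun j hj => hs.echelon.mem j (hj.trans_le h)) ht
    have hid : Identifies t.output ψ := by
      refine identifies_of_linearIndependent hψ _ (fun j => (hsign j).1) ?_
      have hind := hs.echelon.indep
      have hcomp := hind.linearIndependent.comp
        (fun j : Fin n => (⟨j, lt_of_lt_of_le j.2 h⟩ : Set.Iio (s.reg 3)))
        (fun i j hij => Fin.ext (congrArg Subtype.val hij))
      convert hcomp using 1
      funext j
      exact (hsign j).2
    rw [failure, if_pos hid, hyperplanes, Nat.sub_eq_zero_of_le h]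
    norm_num

theorem expect_learner_le (hψ : IsStabilizerState ψ) :
    expect ψ .learner (failure ψ) (Config.init n) ≤ (1 / 2 : ℝ) ^ n := by
  have hw : (Config.init n).weight = 1 := by
    rw [Config.weight_eq, Config.init, normSq, Finset.sum_eq_single 0,
      Finset.sum_eq_single 0] <;> simp +contextual
  have hw0 : 0 ≤ (Config.init n).weight := by rw [hw]; norm_num
  have hinit : (Config.init n).reg 0 = n := rfl
  have main : expect ψ .learner (failure ψ) (Config.init n) ≤
      expect ψ .doubleLength (fun _ => hyperplanes n 0 / 2 ^ (2 * n)) (Config.init n) := by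
    refine expect_seq_le hψ.1 hw0 fun s hs => ?_
    have s0 : s.reg 0 = n := (reg_eq_of_mem_exec hs.1 (by decide)).trans hinit
    have s1 : s.reg 1 = 2 * n := doubleLength_spec hinit rfl hs.1
    have s2 : s.reg 2 = 0 := (reg_eq_of_mem_exec hs.1 (by decide)).trans rfl
    have s3 : s.reg 3 = 0 := (reg_eq_of_mem_exec hs.1 (by decide)).trans rfl
    have sr : ∀ p, row s 2 p = 0 := fun p =>
      (row_eq_of_mem_exec hs.1 (by decide) p).trans rfl
    refine (expect_seq_le hψ.1 hs.2.le (v := fun _ => hyperplanes n 0 / 2 ^ (2 * n))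
      fun t ht => ?_).trans_eq (expect_const hψ.1 _ _ _)
    have t1 : t.reg 1 = 2 * n := (reg_eq_of_mem_exec ht.1 (by decide)).trans s1
    have t3 : t.reg 3 = 0 := (reg_eq_of_mem_exec ht.1 (by decide)).trans s3
    have tinv : LearnInv ψ t :=
      { reg_zero := (reg_eq_of_mem_exec ht.1 (by decide)).trans s0
        reg_one := t1
        reg_two := (reg_eq_of_mem_exec ht.1 (by decide)).trans s2
        offset := pauliCoeff_ne_zero_of_runs s0 s2 ht
        echelon := by
          rw [InEchelon, t3]
          exact echelon_zero _ _ _ fun p =>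
            (row_eq_of_mem_exec ht.1 (by decide) p).trans (sr p) }
    refine (expect_seq_le hψ.1 ht.2.le (v := fun u => hyperplanes n (u.reg 3))
      fun u hu => ?_).trans ?_
    · refine expect_findSigns_le hψ hu.2.le ?_
      exact hu.forLoop hψ.1 (fun _ => LearnInv ψ) ⟨tinv.1, tinv.2, tinv.3, tinv.4, tinv.5⟩
        fun k _ w hw w' hw' => learnRow_inv hψ
          (s := (w.tick 1).setReg 4 k) ⟨hw.1, hw.2, hw.3, hw.4, hw.5⟩ hw'
    · have hloop := expect_forLoop_le (i := 4) (r := 1) (c := .learnRow) hψ.1 ht.2.le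
        (fun _ => LearnInv ψ)
        -- The potential is discounted by the halvings still to come, which makes it a
        -- supermartingale.
        (fun k u => hyperplanes n (u.reg 3) / 2 ^ (2 * n - k))
        ⟨tinv.1, tinv.2, tinv.3, tinv.4, tinv.5⟩
        (fun k _ w hw w' hw' => learnRow_inv hψ
          (s := (w.tick 1).setReg 4 k) ⟨hw.1, hw.2, hw.3, hw.4, hw.5⟩ hw')
        (fun k hk w hw hinv => by
          have h := expect_learnRow_le (s := (w.tick 1).setReg 4 k) hψ hw.le
            ⟨hinv.1, hinv.2, hinv.3, hinv.4, hinv.5⟩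
          rw [t1] at hk
          have hpow : (2 : ℝ) ^ (2 * n - k) = 2 ^ (2 * n - (k + 1)) * 2 := by
            rw [← pow_succ]; congr 1; omega
          simp only [div_eq_mul_inv _ ((2 : ℝ) ^ (2 * n - (k + 1)))]
          have hlin := expect_const_add_mul hψ.1 .learnRow 0 ((2 : ℝ) ^ (2 * n - (k + 1)))⁻¹
            (fun u => hyperplanes n (u.reg 3)) ((w.tick 1).setReg 4 k)
          simp only [zero_add, mul_zero] at hlin
          rw [hlin, hpow]
          refine (mul_le_mul_of_nonneg_right h (by positivity)).trans_eq ?_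
          change w.weight * (hyperplanes n (w.reg 3) / 2) * _ = _
          field_simp)
      simpa [t1, t3] using hloop
  rw [expect_const hψ.1, hw, one_mul] at main
  refine main.trans ?_
  unfold hyperplanes
  -- After clearing the denominator 2^n · 2^n the claim is 2^n - 1 ≤ 2^n.
  rw [Nat.sub_zero, div_le_iff₀ (by positivity), two_mul, pow_add, ← mul_assoc, ← mul_pow]
  norm_num

theorem one_sub_successProb (hψ : IsStabilizerState ψ) (P : Cmd) :
    1 - successProb P ψ = expect ψ P (failure ψ) (Config.init n) := by
  classical
  have hw : (Config.init n).weight = 1 := by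
    rw [Config.weight_eq, Config.init, normSq, Finset.sum_eq_single 0,
      Finset.sum_eq_single 0] <;> simp +contextual
  rw [← hw, ← sum_weight_exec hψ.1 P, successProb, runs, sub_eq_iff_eq_add, expect,
    ← Multiset.sum_map_add]
  congr 1
  refine Multiset.map_congr rfl fun t _ => ?_
  unfold failure
  split_ifs <;> simp

/-! ### Resources -/

/-- Copies: 2 for the offset, 2 for each of the 2n samples, 1 for each of the n signs. The cubic
time comes from 2n eliminations over 2n columns with row operations of length 2n. -/
theorem learner_resources {t : Config n} (ht : t ∈ runs .learner ψ) :
    t.copies ≤ 5 * n + 2 ∧ t.time ≤ 1000 * (n ^ 3 + 1) := by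
  obtain ⟨s, hs, ht⟩ := mem_exec_seq.mp ht
  -- `doubleLength` is treated apart because it writes register 1, which bounds loops in the rest of
  -- the program.
  have h1 := resources_le (S := {0}) (β := fun _ => n) (by simp [Cmd.doubleLength, Cmd.LoopsOn])
    (by decide) (by simp [Config.init]) hs
  have s0 : s.reg 0 = n := (reg_eq_of_mem_exec hs (by decide)).trans rfl
  have s1 : s.reg 1 = 2 * n := doubleLength_spec rfl rfl hs
  have h2 := resources_le (S := {0, 1}) (β := fun r => if r = 0 then n else 2 * n)
    (by simp [Cmd.learnRow, Cmd.bellSample, Cmd.bellLoop, Cmd.firstCols, Cmd.nextCols,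
      Cmd.xorRow, Cmd.copyRow, Cmd.insertRow, Cmd.addPivot, Cmd.findSign, Cmd.signLoop,
      Cmd.measureQubit, Cmd.measureAs, Cmd.LoopsOn])
    (by decide) (by simp [s0, s1]) ht
  simp [Cmd.doubleLength, Cmd.learnRow, Cmd.bellSample, Cmd.bellLoop, Cmd.firstCols,
    Cmd.nextCols, Cmd.xorRow, Cmd.copyRow, Cmd.insertRow, Cmd.addPivot, Cmd.findSign,
    Cmd.signLoop, Cmd.measureQubit, Cmd.measureAs, Cmd.timeBound, Cmd.copyBound,
    Config.init] at h1 h2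
  have e1 : n ≤ n ^ 3 := Nat.le_self_pow (by norm_num) n
  have e2 : n ^ 2 ≤ n ^ 3 := by
    rcases Nat.eq_zero_or_pos n with rfl | hn
    · simp
    · exact Nat.pow_le_pow_right hn (by norm_num)
  refine ⟨by omega, ?_⟩
  nlinarith [h1.1, h2.1]

end BellLearning

theorem theorem1 :
    ∃ (P : BellLearning.Cmd) (C : ℕ), ∀ (n : ℕ) (ψ : BellLearning.Bits n → ℂ),
      BellLearning.IsStabilizerState ψ →
        (∀ s ∈ BellLearning.runs P ψ, 0 < s.weight →
          s.copies ≤ 5 * n + 2 ∧ s.time ≤ C * (n ^ 3 + 1)) ∧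
        1 - BellLearning.successProb P ψ ≤ (1 / 2 : ℝ) ^ n :=
  ⟨BellLearning.Cmd.learner, 1000, fun _ _ hψ =>
    ⟨fun _ hs _ => BellLearning.learner_resources hs, by
      rw [BellLearning.one_sub_successProb hψ]
      exact BellLearning.expect_learner_le hψ⟩⟩
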